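/- Let $(\mathcal S,\mathcal A,p,r,p_0)$ be a finite Markov decision process, $\pi$ a policy, $P_\pi[s,s']=\sum_a\pi(a|s)p(s'|s,a)$, and assume that the Markov chain with transition matrix $P_\pi$ is irreducible and aperiodic, with stationary distribution $d_\pi$. Let $\gamma\in[0,1)$, $\lambda\in[0,1]$, and let $x:\mathcal S\to\mathbb R^d$ be an arbitrary feature map, with feature matrix $X\in\mathbb R^{|\mathcal S|\times d}$ whose $s$-th row is $x(s)^\top$ (no rank assumption). With $D_\pi=\mathrm{diag}(d_\pi)$, $r_\pi(s)=\sum_a\pi(a|s)r(s,a)$, $r_\lambda=(I-\gamma\lambda P_\pi)^{-1}r_\pi$ and $P_\lambda=(1-\lambda)(I-\gamma\lambda P_\pi)^{-1}P_\pi$, put $$A=X^\top D_\pi(\gamma P_\lambda-I)X,\qquad b=X^\top D_\pi r_\lambda,\qquad W_*=\{w\in\mathbb R^d: Aw+b=0\}.$$ Then $W_*$ is nonempty, and there is a constant $c>0$ such that $$w^\top A w\le -c\|w\|^2\quad\text{for all } w\in\ker(A)^\perp. \tag{1}$$ Let $c>0$ be any constant satisfying (1) and let $\xi\in(1/2,1]$.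 Then for all sufficiently large $\alpha>0$ and $t_0>0$, the number $\kappa=\alpha c$ satisfies $\kappa>1$, and there is a constant $C>0$ (which may depend on the decision process, $\pi$, $x$, $\gamma$, $\lambda$, $c$, $\xi$, $\alpha$, $t_0$, but not on $w_0$ or $t$) such that for every $w_0\in\mathbb R^d$ the iterates of discounted linear TD($\lambda$), $$w_{t+1}=w_t+\alpha_t\big(r(S_t,A_t)+\gamma x(S_{t+1})^\top w_t-x(S_t)^\top w_t\big)e_t,\qquad e_t=\gamma\lambda e_{t-1}+x(S_t),\quad e_{-1}=0,$$ with $\alpha_t=\alpha/(t+t_0)^\xi$, along a trajectory $S_0\sim p_0$, $A_t\sim\pi(\cdot|S_t)$, $S_{t+1}\sim p(\cdot|S_t,A_t)$, satisfy for all $t\ge1$ $$\mathbb E\big[d(w_t,W_*)^2\big]\le C\left(\Big(\frac{t_0}{t}\Big)^{\lfloor\kappa\rfloor}d(w_0,W_*)^2+\frac{\ln(t+t_0)}{(t+t_0)^{\min(2\xi-1,\lfloor\kappa\rfloor-1)}}\right),$$ where $d(w,W_*)$ is the Euclidean distance from $w$ to $W_*$. -/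

import Mathlib

open MeasureTheory

/-- A finite Markov decision process with state space `S` and action space `A`:
transition kernel `p s a s' = p(s' | s, a)`, reward `r s a`, initial distribution `p₀`. -/
structure MDP (S A : Type*) [Fintype S] [Fintype A] where
  p : S → A → S → ℝ
  r : S → A → ℝ
  p₀ : S → ℝ
  p_mem : ∀ s a, p s a ∈ stdSimplex ℝ S
  p₀_mem : p₀ ∈ stdSimplex ℝ S

/-- A (stationary, randomized) policy, `prob s a = π(a | s)`. -/
structure Policy (S A : Type*) [Fintype A] where
  prob : S → A → ℝ
  prob_mem : ∀ s, prob s ∈ stdSimplex ℝ A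

/-- Aperiodicity of a transition matrix: for every state `s`, the greatest common divisor of
the return times `{n ≥ 1 | (P ^ n) s s > 0}` is `1`. -/
def Matrix.IsAperiodic {S : Type*} [Fintype S] [DecidableEq S] (P : Matrix S S ℝ) : Prop :=
  ∀ s, ∀ k : ℕ, (∀ n : ℕ, 1 ≤ n → 0 < (P ^ n) s s → k ∣ n) → k = 1

namespace MDP

section Chain

variable {S A : Type*} [Fintype S] [Fintype A]

/-- The state transition matrix `P_π[s, s'] = ∑ a, π(a | s) p(s' | s, a)`. -/
def transMatrix (M : MDP S A) (π : Policy S A) : Matrix S S ℝ :=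
  Matrix.of fun s s' => ∑ a, π.prob s a * M.p s a s'

/-- `d` is a stationary distribution of the chain induced by `π`. -/
def IsStationary (M : MDP S A) (π : Policy S A) (d : S → ℝ) : Prop :=
  d ∈ stdSimplex ℝ S ∧ Matrix.vecMul d (M.transMatrix π) = d

theorem transMatrix_nonneg (M : MDP S A) (π : Policy S A) (s s' : S) :
    0 ≤ M.transMatrix π s s' :=
  Finset.sum_nonneg fun a _ => mul_nonneg ((π.prob_mem s).1 a) ((M.p_mem s a).1 s')

theorem transMatrix_row_sum (M : MDP S A) (π : Policy S A) (s : S) :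
    ∑ s', M.transMatrix π s s' = 1 := by
  simp only [transMatrix, Matrix.of_apply]
  rw [Finset.sum_comm]
  simp only [← Finset.mul_sum, (M.p_mem s _).2, mul_one]
  exact (π.prob_mem s).2

theorem exists_isStationary (M : MDP S A) (π : Policy S A) : ∃ d, M.IsStationary π d := by
  classical
  have hS : Nonempty S := by
    by_contra h
    rw [not_nonempty_iff] at h
    simpa using M.p₀_mem.2
  set P := M.transMatrix π with hP
  have hone : Matrix.mulVec (P - 1) (fun _ => (1 : ℝ)) = 0 := by
    ext s
    rw [Matrix.sub_mulVec, Matrix.one_mulVec]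
    simp [Matrix.mulVec, dotProduct, hP, M.transMatrix_row_sum π s]
  have hdet : (P - 1).det = 0 :=
    Matrix.exists_mulVec_eq_zero_iff.mp
      ⟨_, fun h => one_ne_zero (congrFun h hS.some), hone⟩
  obtain ⟨v, hv0, hv⟩ := Matrix.exists_vecMul_eq_zero_iff.mpr hdet
  have hv' : ∀ s', ∑ s, v s * P s s' = v s' := fun s' => by
    have h := congrFun hv s'
    rw [Matrix.vecMul_sub, Matrix.vecMul_one] at h
    simpa [Matrix.vecMul, dotProduct, sub_eq_zero] using h
  have hle : ∀ s', |v s'| ≤ ∑ s, |v s| * P s s' := fun s' => by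
    rw [← hv' s']
    refine (Finset.abs_sum_le_sum_abs _ _).trans (le_of_eq (Finset.sum_congr rfl fun s _ => ?_))
    rw [abs_mul, abs_of_nonneg (M.transMatrix_nonneg π s s')]
  have hsum : ∑ s', ∑ s, |v s| * P s s' = ∑ s', |v s'| := by
    rw [Finset.sum_comm]
    exact Finset.sum_congr rfl fun s _ => by
      rw [← Finset.mul_sum, hP, M.transMatrix_row_sum π s, mul_one]
  have heq : ∀ s', |v s'| = ∑ s, |v s| * P s s' := fun s' =>
    (Finset.sum_eq_sum_iff_of_le fun i _ => hle i).mp hsum.symm s' (Finset.mem_univ _)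
  have hpos : 0 < ∑ s, |v s| := by
    obtain ⟨s, hs⟩ := Function.ne_iff.mp hv0
    exact Finset.sum_pos' (fun _ _ => abs_nonneg _) ⟨s, Finset.mem_univ _, abs_pos.mpr hs⟩
  refine ⟨fun s => |v s| / ∑ i, |v i|, ⟨fun s => by positivity, ?_⟩, ?_⟩
  · rw [← Finset.sum_div, div_self hpos.ne']
  · ext s'
    simp only [Matrix.vecMul, dotProduct]
    rw [heq s', Finset.sum_div]
    exact Finset.sum_congr rfl fun s _ => by ring

/-- The stationary distribution `d_π` (unique as soon as the chain is irreducible). -/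
noncomputable def statDist (M : MDP S A) (π : Policy S A) : S → ℝ :=
  (M.exists_isStationary π).choose

theorem statDist_spec (M : MDP S A) (π : Policy S A) : M.IsStationary π (M.statDist π) :=
  (M.exists_isStationary π).choose_spec

/-- Expected immediate reward `r_π(s) = ∑ a, π(a | s) r(s, a)`. -/
def rPi (M : MDP S A) (π : Policy S A) (s : S) : ℝ := ∑ a, π.prob s a * M.r s a

/-- On the probability space `(Ω, μ)`, the processes `(X_t)` of states and `(U_t)` of actions
form a trajectory of the MDP under the policy `π`: `X_0 ∼ p₀`, `U_t ∼ π(· | X_t)`,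
`X_{t+1} ∼ p(· | X_t, U_t)`, expressed through the finite-dimensional laws. -/
structure IsTrajectory (M : MDP S A) (π : Policy S A) {Ω : Type*} [MeasurableSpace Ω]
    (μ : Measure Ω) (X : ℕ → Ω → S) (U : ℕ → Ω → A) : Prop where
  measurable_state : ∀ t s, MeasurableSet {ω | X t ω = s}
  measurable_action : ∀ t a, MeasurableSet {ω | U t ω = a}
  law : ∀ (t : ℕ) (s : ℕ → S) (a : ℕ → A),
    μ.real {ω | (∀ i ≤ t, X i ω = s i) ∧ ∀ i < t, U i ω = a i} =
      M.p₀ (s 0) * ∏ i ∈ Finset.range t, (π.prob (s i) (a i) * M.p (s i) (a i) (s (i + 1)))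

end Chain

section Lambda

variable {S A : Type*} [Fintype S] [DecidableEq S] [Fintype A]

/-- `r_λ = (I - γ λ P_π)⁻¹ r_π`. -/
noncomputable def rLam (M : MDP S A) (π : Policy S A) (γ lam : ℝ) : S → ℝ :=
  Matrix.mulVec (1 - (γ * lam) • M.transMatrix π)⁻¹ (M.rPi π)

/-- `P_λ = (1 - λ) (I - γ λ P_π)⁻¹ P_π`. -/
noncomputable def PLam (M : MDP S A) (π : Policy S A) (γ lam : ℝ) : Matrix S S ℝ :=
  (1 - lam) • ((1 - (γ * lam) • M.transMatrix π)⁻¹ * M.transMatrix π)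

/-- The feature matrix, whose `s`-th row is the feature vector `x s`. -/
def featMatrix {d : ℕ} (x : S → EuclideanSpace ℝ (Fin d)) : Matrix S (Fin d) ℝ :=
  Matrix.of fun s i => x s i

/-- `A = Xᵀ D_π (γ P_λ - I) X`. -/
noncomputable def tdA (M : MDP S A) (π : Policy S A) (γ lam : ℝ) {d : ℕ}
    (x : S → EuclideanSpace ℝ (Fin d)) : Matrix (Fin d) (Fin d) ℝ :=
  (featMatrix x).transpose * Matrix.diagonal (M.statDist π) * (γ • M.PLam π γ lam - 1) *
    featMatrix x

/-- `b = Xᵀ D_π r_λ`. -/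
noncomputable def tdb (M : MDP S A) (π : Policy S A) (γ lam : ℝ) {d : ℕ}
    (x : S → EuclideanSpace ℝ (Fin d)) : Fin d → ℝ :=
  Matrix.mulVec ((featMatrix x).transpose * Matrix.diagonal (M.statDist π)) (M.rLam π γ lam)

/-- `W_* = {w | A w + b = 0}`. -/
def solSet (M : MDP S A) (π : Policy S A) (γ lam : ℝ) {d : ℕ}
    (x : S → EuclideanSpace ℝ (Fin d)) : Set (EuclideanSpace ℝ (Fin d)) :=
  {w | Matrix.mulVec (M.tdA π γ lam x) w.ofLp + M.tdb π γ lam x = 0}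

end Lambda

section TD

variable {S A : Type*} [Fintype S] [Fintype A] {d : ℕ}

/-- Eligibility trace along a state sequence: `e_t = γ λ e_{t-1} + x(s_t)`, `e_{-1} = 0`. -/
noncomputable def trace (γ lam : ℝ) (x : S → EuclideanSpace ℝ (Fin d)) (s : ℕ → S) :
    ℕ → EuclideanSpace ℝ (Fin d)
  | 0 => x (s 0)
  | t + 1 => (γ * lam) • trace γ lam x s t + x (s (t + 1))

/-- Discounted linear TD(λ) with step sizes `α`, started at `w₀`, along a state sequence `s` and
an action sequence `a`:
`w_{t+1} = w_t + α_t (r(s_t, a_t) + γ x(s_{t+1})ᵀ w_t - x(s_t)ᵀ w_t) e_t`. -/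
noncomputable def tdIter (M : MDP S A) (γ lam : ℝ) (x : S → EuclideanSpace ℝ (Fin d))
    (α : ℕ → ℝ) (w₀ : EuclideanSpace ℝ (Fin d)) (s : ℕ → S) (a : ℕ → A) :
    ℕ → EuclideanSpace ℝ (Fin d)
  | 0 => w₀
  | t + 1 =>
    let w := tdIter M γ lam x α w₀ s a t
    w + (α t * (M.r (s t) (a t) + γ * inner ℝ (x (s (t + 1))) w - inner ℝ (x (s t)) w)) •
      trace γ lam x s t

end TD

end MDP

/-- `B` is negative definite with constant `c` on `ker(B)^⊥`:
`wᵀ B w ≤ -c ‖w‖²` for every `w` in the orthogonal complement of the kernel of `B`. -/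
def Matrix.NegDefOnKerPerp {d : ℕ} (B : Matrix (Fin d) (Fin d) ℝ) (c : ℝ) : Prop :=
  ∀ w ∈ (LinearMap.ker (Matrix.toEuclideanLin B))ᗮ,
    inner ℝ w (Matrix.toEuclideanLin B w) ≤ -c * ‖w‖ ^ 2

/-!
Mean square convergence of linear TD(λ) without a rank assumption on the features.

*Reduction to `ker(A)ᗮ`.* Write `P = P_π`. Since `γ P_λ - 1 = (1 - γ λ P)⁻¹ (γ P - 1)`, the form
`⟨w, A w⟩` becomes, in `z = (1 - γ λ P)⁻¹ X w`, the form `⟨z - γ λ P z, γ P z - z⟩` of `ℓ²(d_π)`. As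
`P` is a contraction of `ℓ²(d_π)`, it is at most `-(1 - γ) (1 - γ λ) ‖z‖²`
(`sum_stationary_resolvent_form_le`). Hence `ker A = ker X`, the form is negative definite on
`ker(A)ᗮ`, and `W_*` is a nonempty translate of `ker A`. All features lie in `ker(A)ᗮ`, so the
component of the iterate in `ker A` never moves, and `d(w_t, W_*)` is the norm of the projection
`u_t` of `w_t - w_*` to `ker(A)ᗮ`, which itself follows the TD recursion.

*Markovian noise.* The chain `(S_t, e_t)` has an infinite state space, but the update is affine in
the trace. So the Poisson equation for the increment of `‖u‖²`, with `u` frozen, is solved by the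
resolvent `(1 - γ λ P)⁻¹` for the part that is linear in `e` and by a Poisson kernel on the finite set
`S` for the rest (`MDP.poissonFun`, `MDP.inner_mul_meanError_eq`). Such a kernel exists for every
irreducible chain, since harmonic functions are constant. With `Q` the resulting function,
`m_t = E[‖u_t‖² + 2 α_t Q(S_t, e_t, u_t)]` satisfies
`m_{t+1} ≤ m_t - 2 c α_t E‖u_t‖² + O(α_t²) (1 + E‖u_t‖²)`, without any mixing time argument and
hence without a logarithm.

*Rate.* For `κ = α c ≥ 2` and `τ = t + t₀`, the powers `τ ^ (-⌊κ⌋)` and `τ ^ (-(2 ξ - 1))` are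
supersolutions of `m ↦ (1 - c α_t) m + O(α_t²)` (`exists_bound_of_lyapunov_recursion`), and
`2 ξ - 1` is the minimum in the exponent. The logarithm in the claimed bound is only used to be
bounded below by `log 2`.
-/

/-! ### Irreducible chains: stationary law, Poisson equation, resolvent -/

section StochasticMatrix

open Matrix

variable {S : Type*} [Fintype S] {P : Matrix S S ℝ} {μ : S → ℝ}

theorem sum_stationary_mulVec (hμ : μ ᵥ* P = μ) (f : S → ℝ) :
    ∑ s, μ s * (P *ᵥ f) s = ∑ s, μ s * f s := by
  have h : μ ⬝ᵥ (P *ᵥ f) = μ ⬝ᵥ f := by rw [dotProduct_mulVec, hμ]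
  exact h

/-- Jensen's inequality for the rows of `P`, integrated against a stationary law: `P` is a
contraction of `ℓ²(μ)`. -/
theorem sum_stationary_mulVec_sq_le (hP0 : ∀ i j, 0 ≤ P i j) (hP1 : ∀ i, ∑ j, P i j = 1)
    (hμ0 : ∀ i, 0 ≤ μ i) (hμ : μ ᵥ* P = μ) (z : S → ℝ) :
    ∑ s, μ s * (P *ᵥ z) s ^ 2 ≤ ∑ s, μ s * z s ^ 2 := by
  rw [← sum_stationary_mulVec hμ fun s => z s ^ 2]
  refine Finset.sum_le_sum fun s _ => mul_le_mul_of_nonneg_left ?_ (hμ0 s)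
  have h : 0 ≤ ∑ j, P s j * (z j - (P *ᵥ z) s) ^ 2 :=
    Finset.sum_nonneg fun j _ => mul_nonneg (hP0 s j) (sq_nonneg _)
  have h2 : ∑ j, P s j * (z j - (P *ᵥ z) s) ^ 2
      = ∑ j, P s j * z j ^ 2 - 2 * (P *ᵥ z) s * ∑ j, P s j * z j
        + (P *ᵥ z) s ^ 2 * ∑ j, P s j := by
    simp only [Finset.mul_sum, ← Finset.sum_sub_distrib, ← Finset.sum_add_distrib]
    exact Finset.sum_congr rfl fun j _ => by ring
  have h3 : ∑ j, P s j * z j = (P *ᵥ z) s := rfl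
  have h4 : (P *ᵥ fun s => z s ^ 2) s = ∑ j, P s j * z j ^ 2 := rfl
  rw [h2, h3, hP1] at h
  rw [h4]
  nlinarith

/-- With `y = z - β P z`, so that `z = (1 - β P)⁻¹ y`, the form `⟨y, (γ P - 1) z⟩` of `ℓ²(μ)` is
negative definite in `z`; this is the form behind `A`, because
`γ P_λ - 1 = (1 - γ λ P)⁻¹ (γ P - 1)`. -/
theorem sum_stationary_resolvent_form_le (hP0 : ∀ i j, 0 ≤ P i j) (hP1 : ∀ i, ∑ j, P i j = 1)
    (hμ0 : ∀ i, 0 ≤ μ i) (hμ : μ ᵥ* P = μ) {γ β : ℝ} (hγ0 : 0 ≤ γ) (hγ1 : γ ≤ 1)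
    (hβ0 : 0 ≤ β) (hβ1 : β ≤ 1) (z : S → ℝ) :
    ∑ s, μ s * ((z s - β * (P *ᵥ z) s) * (γ * (P *ᵥ z) s - z s)) ≤
      -((1 - γ) * (1 - β)) * ∑ s, μ s * z s ^ 2 := by
  have h1 := sum_stationary_mulVec_sq_le hP0 hP1 hμ0 hμ z
  have h2 : ∑ s, μ s * ((z s - β * (P *ᵥ z) s) * (γ * (P *ᵥ z) s - z s)) ≤
      ∑ s, (((γ + β) / 2 - 1) * (μ s * z s ^ 2)
        + ((γ + β) / 2 - β * γ) * (μ s * (P *ᵥ z) s ^ 2)) := by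
    refine Finset.sum_le_sum fun s _ => ?_
    have := mul_nonneg (mul_nonneg (add_nonneg hγ0 hβ0) (hμ0 s)) (sq_nonneg (z s - (P *ᵥ z) s))
    nlinarith
  rw [Finset.sum_add_distrib, ← Finset.mul_sum, ← Finset.mul_sum] at h2
  have h3 : 0 ≤ (γ + β) / 2 - β * γ := by nlinarith
  have := mul_le_mul_of_nonneg_left h1 h3
  nlinarith

variable [DecidableEq S]

theorem vecMul_pow_of_vecMul (hμ : μ ᵥ* P = μ) (k : ℕ) : μ ᵥ* P ^ k = μ := by
  induction k with
  | zero => simp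
  | succ k ih => rw [pow_succ, ← vecMul_vecMul, ih, hμ]

theorem pow_mulVec_of_mulVec {f : S → ℝ} (hf : P *ᵥ f = f) (k : ℕ) : P ^ k *ᵥ f = f := by
  induction k with
  | zero => simp
  | succ k ih => rw [pow_succ, ← mulVec_mulVec, hf, ih]

theorem stationary_pos (hirr : P.IsIrreducible) (hμ0 : μ ∈ stdSimplex ℝ S) (hμ : μ ᵥ* P = μ)
    (s : S) : 0 < μ s := by
  obtain ⟨s₀, hs₀⟩ : ∃ s₀, 0 < μ s₀ := by
    by_contra! h
    have := Finset.sum_nonpos fun i (_ : i ∈ Finset.univ) => h i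
    rw [hμ0.2] at this
    linarith
  obtain ⟨k, -, hk⟩ := (isIrreducible_iff_exists_pow_pos hirr.nonneg).1 hirr s₀ s
  have h := congrFun (vecMul_pow_of_vecMul hμ k) s
  rw [← h]
  refine lt_of_lt_of_le (mul_pos hs₀ hk) ?_
  exact Finset.single_le_sum (f := fun i => μ i * (P ^ k) i s)
    (fun i _ => mul_nonneg (hμ0.1 i) (pow_apply_nonneg hirr.nonneg k i s)) (Finset.mem_univ s₀)

/-- Maximum principle: a harmonic function of an irreducible chain is constant. -/
theorem eq_of_mulVec_eq_self (hirr : P.IsIrreducible) (hP1 : ∀ i, ∑ j, P i j = 1)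
    {f : S → ℝ} (hf : P *ᵥ f = f) (i j : S) : f i = f j := by
  have : Nonempty S := ⟨i⟩
  obtain ⟨m, hm⟩ := Finite.exists_max f
  suffices h : ∀ l, f l = f m by rw [h i, h j]
  intro l
  obtain ⟨k, -, hk⟩ := (isIrreducible_iff_exists_pow_pos hirr.nonneg).1 hirr m l
  have h1 : ∑ j, (P ^ k) m j = 1 := by
    have h : P *ᵥ (fun _ => (1 : ℝ)) = fun _ => 1 := by
      ext i
      simpa [mulVec, dotProduct] using hP1 i
    simpa [mulVec, dotProduct] using congrFun (pow_mulVec_of_mulVec h k) m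
  have h2 : ∑ j, (P ^ k) m j * f j = f m := congrFun (pow_mulVec_of_mulVec hf k) m
  have h3 : ∑ j, (P ^ k) m j * (f m - f j) = 0 := by
    simp only [mul_sub, Finset.sum_sub_distrib, ← Finset.sum_mul, h1, h2]
    ring
  have h4 := (Finset.sum_eq_zero_iff_of_nonneg fun j _ =>
    mul_nonneg (pow_apply_nonneg hirr.nonneg k m j) (sub_nonneg.2 (hm j))).1 h3 l
      (Finset.mem_univ l)
  rcases mul_eq_zero.1 h4 with h | h
  · exact absurd h hk.ne'
  · linarith

/-- A solution operator `Z` of the Poisson equation `h - P h = f - μ(f)` of an irreducible chain.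
Aperiodicity plays no role: `1 - P + 𝟙 μᵀ` is injective as soon as harmonic functions are
constant. -/
theorem exists_poisson_kernel (hirr : P.IsIrreducible) (hP1 : ∀ i, ∑ j, P i j = 1)
    (hμ1 : ∑ i, μ i = 1) (hμ : μ ᵥ* P = μ) :
    ∃ Z : S → S → ℝ, ∀ s i, Z s i - ∑ s', P s s' * Z s' i = (if s = i then 1 else 0) - μ i := by
  let T : (S → ℝ) →ₗ[ℝ] (S → ℝ) :=
    LinearMap.id - P.mulVecLin + (dotProductBilin ℝ ℝ μ).smulRight (fun _ => (1 : ℝ))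
  have hT : ∀ f s, T f s = f s - (P *ᵥ f) s + ∑ i, μ i * f i := fun f s => by
    simp [T, dotProduct]
  have hmean : ∀ f, ∑ s, μ s * T f s = ∑ s, μ s * f s := fun f => by
    simp only [hT, mul_add, mul_sub, Finset.sum_add_distrib, Finset.sum_sub_distrib,
      sum_stationary_mulVec hμ, ← Finset.sum_mul, hμ1]
    ring
  have hinj : Function.Injective T := by
    rw [injective_iff_map_eq_zero]
    intro f hf
    have h0 : ∑ s, μ s * f s = 0 := by rw [← hmean, hf]; simp
    have hP : P *ᵥ f = f := by
      ext s
      have := hT f s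
      rw [hf, h0] at this
      simp only [Pi.zero_apply] at this
      linarith
    ext s
    have h : ∑ i, μ i * f i = f s := by
      rw [Finset.sum_congr rfl fun i _ => by rw [eq_of_mulVec_eq_self hirr hP1 hP i s],
        ← Finset.sum_mul, hμ1, one_mul]
    rw [← h, h0]; rfl
  have hsurj := LinearMap.injective_iff_surjective.1 hinj
  choose Z hZ using fun i : S => hsurj fun s => (if s = i then 1 else 0) - μ i
  refine ⟨fun s i => Z i s, fun s i => ?_⟩
  have h1 := hT (Z i) s
  have h2 : ∑ s, μ s * Z i s = 0 := by
    rw [← hmean, hZ]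
    simp [mul_sub, ← Finset.sum_mul, hμ1]
  rw [hZ, h2] at h1
  simp only [mulVec, dotProduct] at h1
  linarith

theorem isUnit_det_one_sub_smul (hP0 : ∀ i j, 0 ≤ P i j) (hP1 : ∀ i, ∑ j, P i j = 1)
    {β : ℝ} (hβ0 : 0 ≤ β) (hβ1 : β < 1) : IsUnit (1 - β • P).det := by
  refine isUnit_iff_ne_zero.2 (det_ne_zero_of_sum_row_lt_diag fun k => ?_)
  have h1 := Finset.add_sum_erase Finset.univ (fun j => P k j) (Finset.mem_univ k)
  rw [hP1] at h1
  have h2 : ∑ j ∈ Finset.univ.erase k, ‖(1 - β • P) k j‖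
      = β * ∑ j ∈ Finset.univ.erase k, P k j := by
    rw [Finset.mul_sum]
    refine Finset.sum_congr rfl fun j hj => ?_
    rw [Matrix.sub_apply, one_apply_ne (Finset.ne_of_mem_erase hj).symm]
    simp [abs_of_nonneg hβ0, abs_of_nonneg (hP0 k j)]
  have h3 : P k k ≤ 1 := by
    have := Finset.sum_nonneg fun j (_ : j ∈ Finset.univ.erase k) => hP0 k j
    linarith
  have h4 : 1 - β * P k k ≤ ‖(1 - β • P) k k‖ := by
    simpa using le_abs_self (1 - β * P k k)
  rw [h2]
  nlinarith

end StochasticMatrix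

/-! ### The scalar recursion -/

section Recursion

open Filter Topology

theorem one_sub_div_mul_inv_pow_le {τ κ : ℝ} (hτ : 1 ≤ τ) {n : ℕ} (hn : (n : ℝ) ≤ κ) :
    (1 - κ / τ) * (τ ^ n)⁻¹ ≤ ((τ + 1) ^ n)⁻¹ := by
  have h0 : 0 < τ := by linarith
  have h1 : 1 - κ / τ ≤ (τ / (τ + 1)) ^ n := by
    have hb := one_add_mul_le_pow (a := -(1 / (τ + 1))) (by
      have : 1 / (τ + 1) ≤ 1 := by rw [div_le_one (by linarith)]; linarith
      linarith) n
    have e : 1 + -(1 / (τ + 1)) = τ / (τ + 1) := by field_simp; ring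
    rw [e] at hb
    refine le_trans ?_ hb
    have h2 : (n : ℝ) * (1 / (τ + 1)) ≤ κ / τ := by
      rw [mul_one_div]
      exact div_le_div₀ (le_trans (Nat.cast_nonneg n) hn) hn h0 (by linarith)
    linarith
  calc (1 - κ / τ) * (τ ^ n)⁻¹ ≤ (τ / (τ + 1)) ^ n * (τ ^ n)⁻¹ := by gcongr
    _ = ((τ + 1) ^ n)⁻¹ := by rw [div_pow]; field_simp

theorem one_sub_div_mul_rpow_neg_le {τ q : ℝ} (hτ : 1 ≤ τ) (hq0 : 0 ≤ q) (hq1 : q ≤ 1) :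
    (1 - q / τ) * τ ^ (-q) ≤ (τ + 1) ^ (-q) := by
  have h0 : 0 < τ := by linarith
  have hb := rpow_one_add_le_one_add_mul_self (s := 1 / τ)
    (by have := div_pos one_pos h0; linarith) hq0 hq1
  have e : τ + 1 = τ * (1 + 1 / τ) := by field_simp
  have hp : 0 < 1 + 1 / τ := by positivity
  rw [e, Real.mul_rpow h0.le hp.le, mul_comm, Real.rpow_neg hp.le]
  refine mul_le_mul_of_nonneg_left ?_ (Real.rpow_nonneg h0.le _)
  have hpos : 0 < (1 + 1 / τ) ^ q := Real.rpow_pos_of_pos hp q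
  rw [mul_one_div] at hb
  rw [← one_div, le_div_iff₀ hpos]
  by_cases h : 0 ≤ 1 - q / τ
  · have := mul_le_mul_of_nonneg_left hb h
    nlinarith [sq_nonneg (q / τ)]
  · nlinarith

/-- A Lyapunov sequence `m`, equal to `ℓ` up to a relative error of the order of the step size
`a t = α / (t + t₀) ^ ξ`, that contracts at rate `2 c a t` up to an error of second order. Half of
the rate pays for the errors, and then `(t + t₀) ^ (-⌊α c⌋)` and `(t + t₀) ^ (-(2 ξ - 1))` are
supersolutions of the remaining recursion `m (t + 1) ≤ (1 - c a t) m t + O((a t) ^ 2)`. The finitely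
many initial steps, where the step size is not yet small, are covered by the crude growth
bound `R`. -/
theorem exists_bound_of_lyapunov_recursion {c α t₀ ξ K R : ℝ} (hc : 0 < c) (hα : 2 ≤ α * c)
    (ht₀ : 1 ≤ t₀) (hξ0 : 1 / 2 < ξ) (hξ1 : ξ ≤ 1) (hK : 0 ≤ K) (hR : 1 ≤ R) :
    ∃ C : ℝ, 0 < C ∧ ∀ a ℓ m : ℕ → ℝ, (∀ t : ℕ, a t = α / ((t : ℝ) + t₀) ^ ξ) → (∀ t, 0 ≤ ℓ t) →
      (∀ t, |m t - ℓ t| ≤ K * a t * (1 + ℓ t)) →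
      (∀ t, m (t + 1) ≤ m t - 2 * c * a t * ℓ t + K * a t ^ 2 * (1 + ℓ t)) →
      (∀ t, 1 + ℓ (t + 1) ≤ R * (1 + ℓ t)) →
      ∀ t : ℕ, ℓ t ≤ C * ((((t : ℝ) + t₀) ^ ⌊α * c⌋₊)⁻¹ * ℓ 0
        + ((t : ℝ) + t₀) ^ (-(2 * ξ - 1))) := by
  have hα0 : 0 < α := by
    by_contra! h
    nlinarith
  set n := ⌊α * c⌋₊ with hn
  have hnκ : (n : ℝ) ≤ α * c := Nat.floor_le (by linarith)
  have hn1 : 1 ≤ n := Nat.le_floor (by push_cast; linarith)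
  set q := 2 * ξ - 1 with hq
  have hq0 : 0 ≤ q := by rw [hq]; linarith
  have hq1 : q ≤ 1 := by rw [hq]; linarith
  obtain ⟨T, hT⟩ : ∃ T : ℕ, ∀ t : ℕ, T ≤ t → α / ((t : ℝ) + t₀) ^ ξ * (K + c) ≤ min (c / 2) (1 / 2) := by
    have h1 : Tendsto (fun t : ℕ => ((t : ℝ) + t₀) ^ ξ) atTop atTop :=
      (tendsto_rpow_atTop (by linarith)).comp
        (tendsto_atTop_add_const_right _ _ tendsto_natCast_atTop_atTop)
    have h2 : Tendsto (fun t : ℕ => α / ((t : ℝ) + t₀) ^ ξ * (K + c)) atTop (𝓝 0) := by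
      simpa using (h1.const_div_atTop α).mul_const (K + c)
    obtain ⟨T, hT⟩ := eventually_atTop.1 (h2.eventually_le_const (by positivity :
      (0 : ℝ) < min (c / 2) (1 / 2)))
    exact ⟨T, hT⟩
  set K' := (c * K + K) * α ^ 2 with hK'
  have hK'0 : 0 ≤ K' := by positivity
  set G := 2 * R ^ T * ((T : ℝ) + t₀) ^ n with hG
  have hG0 : 0 ≤ G := by positivity
  refine ⟨2 * (G + K') + 2 * K * α + 1, by positivity, ?_⟩
  intro a ℓ m ha hℓ hmℓ hm hgrow
  have hτ : ∀ t : ℕ, 1 ≤ (t : ℝ) + t₀ := fun t => by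
    have := Nat.cast_nonneg (α := ℝ) t; linarith
  have hτ0 : ∀ t : ℕ, 0 < (t : ℝ) + t₀ := fun t => by linarith [hτ t]
  have ha0 : ∀ t, 0 ≤ a t := fun t => by rw [ha]; have := hτ0 t; positivity
  set D : ℕ → ℝ := fun t => ((t : ℝ) + t₀) ^ (-q) with hD
  set B : ℕ → ℝ := fun t => (((t : ℝ) + t₀) ^ n)⁻¹ with hB
  have hD0 : ∀ t, 0 < D t := fun t => Real.rpow_pos_of_pos (hτ0 t) _
  have hB0 : ∀ t, 0 < B t := fun t => by have := hτ0 t; simp only [hB]; positivity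
  have hBD : ∀ t, B t ≤ D t := fun t => by
    simp only [hB, hD]
    rw [← Real.rpow_natCast, ← Real.rpow_neg (hτ0 t).le]
    refine Real.rpow_le_rpow_of_exponent_le (hτ t) ?_
    have : (1 : ℝ) ≤ n := by exact_mod_cast hn1
    linarith
  have haD : ∀ t, a t ≤ α * D t := fun t => by
    rw [ha, div_eq_mul_inv, ← Real.rpow_neg (hτ0 t).le]
    refine mul_le_mul_of_nonneg_left ?_ hα0.le
    exact Real.rpow_le_rpow_of_exponent_le (hτ t) (by rw [hq]; linarith)
  have hξτ : ∀ t : ℕ, ((t : ℝ) + t₀)⁻¹ ≤ (((t : ℝ) + t₀) ^ ξ)⁻¹ := fun t => by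
    rw [← Real.rpow_neg_one, ← Real.rpow_neg (hτ0 t).le]
    exact Real.rpow_le_rpow_of_exponent_le (hτ t) (by linarith)
  have hca : ∀ t, c * a t = α * c * (((t : ℝ) + t₀) ^ ξ)⁻¹ := fun t => by
    rw [ha]; ring
  have hBstep : ∀ t, (1 - c * a t) * B t ≤ B (t + 1) := fun t => by
    have h1 := one_sub_div_mul_inv_pow_le (hτ t) hnκ
    have e : (((t + 1 : ℕ) : ℝ) + t₀) = (t : ℝ) + t₀ + 1 := by push_cast; ring
    simp only [hB] at hB0 ⊢
    rw [e]
    refine le_trans (mul_le_mul_of_nonneg_right ?_ (hB0 t).le) h1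
    rw [hca, div_eq_mul_inv]
    have := mul_le_mul_of_nonneg_left (hξτ t) (by linarith : 0 ≤ α * c)
    linarith
  have hDstep : ∀ t, (1 - c * a t) * D t + a t ^ 2 / α ^ 2 ≤ D (t + 1) := fun t => by
    have h1 := one_sub_div_mul_rpow_neg_le (hτ t) hq0 hq1
    have e : (((t + 1 : ℕ) : ℝ) + t₀) = (t : ℝ) + t₀ + 1 := by push_cast; ring
    have h2 : a t ^ 2 / α ^ 2 ≤ (((t : ℝ) + t₀) ^ ξ)⁻¹ * D t := by
      have h3 : a t ^ 2 / α ^ 2 = (((t : ℝ) + t₀) ^ ξ)⁻¹ * (((t : ℝ) + t₀) ^ ξ)⁻¹ := by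
        rw [ha]; field_simp
      rw [h3]
      refine mul_le_mul_of_nonneg_left ?_ (inv_nonneg.2 (Real.rpow_nonneg (hτ0 t).le _))
      rw [← Real.rpow_neg (hτ0 t).le]
      exact Real.rpow_le_rpow_of_exponent_le (hτ t) (by rw [hq]; linarith)
    have h4 : q * ((t : ℝ) + t₀)⁻¹ ≤ (((t : ℝ) + t₀) ^ ξ)⁻¹ := by
      have := mul_le_mul_of_nonneg_right hq1 (inv_nonneg.2 (hτ0 t).le)
      linarith [hξτ t]
    have h5 := mul_le_mul_of_nonneg_right hα (inv_nonneg.2 (Real.rpow_nonneg (hτ0 t).le ξ))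
    have h6 : (1 - c * a t + (((t : ℝ) + t₀) ^ ξ)⁻¹) * D t ≤ (1 - q / ((t : ℝ) + t₀)) * D t := by
      refine mul_le_mul_of_nonneg_right ?_ (hD0 t).le
      rw [hca, div_eq_mul_inv]
      linarith
    simp only [hD] at *
    rw [e]
    linarith
  set F : ℕ → ℝ := fun t => B t * ℓ 0 + D t with hF
  have hF0 : ∀ t, 0 ≤ F t := fun t =>
    add_nonneg (mul_nonneg (hB0 t).le (hℓ 0)) (hD0 t).le
  have hpow : ∀ t, 1 + ℓ t ≤ R ^ t * (1 + ℓ 0) := by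
    intro t
    induction t with
    | zero => simp
    | succ t ih =>
      refine (hgrow t).trans ?_
      rw [pow_succ', mul_assoc]
      exact mul_le_mul_of_nonneg_left ih (by linarith)
  -- Up to time `T` the target bound is of the order of `1 + ℓ 0`.
  have hearly : ∀ t, t ≤ T → 2 * (1 + ℓ t) ≤ G * F t := by
    intro t ht
    have h1 : 1 ≤ ((T : ℝ) + t₀) ^ n * B t := by
      simp only [hB]
      rw [← div_eq_mul_inv, one_le_div (pow_pos (hτ0 t) n)]
      have := hτ0 t
      gcongr
    have h2 : 1 ≤ ((T : ℝ) + t₀) ^ n * D t :=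
      h1.trans (mul_le_mul_of_nonneg_left (hBD t) (pow_nonneg (hτ0 T).le n))
    have h3 : 1 + ℓ 0 ≤ ((T : ℝ) + t₀) ^ n * F t := by
      have := mul_le_mul_of_nonneg_right h1 (hℓ 0)
      simp only [hF]
      linarith
    calc 2 * (1 + ℓ t) ≤ 2 * (R ^ T * (1 + ℓ 0)) := by
          have h4 : R ^ t ≤ R ^ T := pow_le_pow_right₀ hR ht
          have := mul_le_mul_of_nonneg_right h4 (by linarith [hℓ 0] : 0 ≤ 1 + ℓ 0)
          linarith [hpow t]
      _ ≤ 2 * (R ^ T * (((T : ℝ) + t₀) ^ n * F t)) := by gcongr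
      _ = G * F t := by rw [hG]; ring
  have hsmall : ∀ t, T ≤ t → K * a t ≤ c / 2 ∧ K * a t ≤ 1 / 2 ∧ c * a t ≤ 1 := by
    intro t ht
    have h := hT t ht
    rw [← ha] at h
    have h1 := h.trans (min_le_left _ _)
    have h2 := h.trans (min_le_right _ _)
    have h3 := mul_nonneg hK (ha0 t)
    have h4 := mul_nonneg hc.le (ha0 t)
    refine ⟨?_, ?_, ?_⟩ <;> nlinarith
  have hstep : ∀ t, T ≤ t → m (t + 1) ≤ (1 - c * a t) * m t + (c * K + K) * a t ^ 2 := by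
    intro t ht
    obtain ⟨h1, h2, -⟩ := hsmall t ht
    have h3 := (abs_le.1 (hmℓ t)).2
    have h4 : m t - K * a t ≤ 3 / 2 * ℓ t := by
      have := mul_le_mul_of_nonneg_right h2 (hℓ t)
      linarith
    have h5 := mul_le_mul_of_nonneg_left h4 (mul_nonneg hc.le (ha0 t))
    have h6 := mul_le_mul_of_nonneg_right h1 (mul_nonneg (ha0 t) (hℓ t))
    have h7 := hm t
    nlinarith
  have hmF : ∀ t, T ≤ t → m t ≤ (G + K') * F t := by
    intro t ht
    induction t, ht using Nat.le_induction with
    | base =>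
      have h1 := (abs_le.1 (hmℓ T)).2
      have h2 := mul_le_mul_of_nonneg_right (hsmall T le_rfl).2.1
        (by linarith [hℓ T] : 0 ≤ 1 + ℓ T)
      have h3 := hearly T le_rfl
      have h4 := mul_nonneg hK'0 (hF0 T)
      have := hℓ T
      linarith
    | succ t ht ih =>
      have h1 := hstep t ht
      have h2 : 0 ≤ 1 - c * a t := by linarith [(hsmall t ht).2.2]
      have h3 := mul_le_mul_of_nonneg_left ih h2
      have h4 : (1 - c * a t) * F t + a t ^ 2 / α ^ 2 ≤ F (t + 1) := by
        have := mul_le_mul_of_nonneg_right (hBstep t) (hℓ 0)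
        have := hDstep t
        simp only [hF]
        linarith
      have h5 := mul_le_mul_of_nonneg_left h4 (add_nonneg hG0 hK'0)
      have h6 : (c * K + K) * a t ^ 2 = K' * (a t ^ 2 / α ^ 2) := by
        rw [hK']; field_simp
      have h7 : 0 ≤ G * (a t ^ 2 / α ^ 2) := by positivity
      linarith
  intro t
  change ℓ t ≤ _ * F t
  have hFt := hF0 t
  rcases le_total t T with ht | ht
  · have h1 := hearly t ht
    have h2 := mul_nonneg hG0 hFt
    have h3 := mul_nonneg hK'0 hFt
    have h4 : 0 ≤ 2 * K * α * F t := by positivity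
    have := hℓ t
    linarith
  · have h1 := hmF t ht
    have h2 := (abs_le.1 (hmℓ t)).1
    have h3 := mul_le_mul_of_nonneg_right (hsmall t ht).2.1 (hℓ t)
    have h4 := mul_le_mul_of_nonneg_left (haD t) hK
    have h5 : D t ≤ F t := le_add_of_nonneg_left (mul_nonneg (hB0 t).le (hℓ 0))
    have h6 := mul_le_mul_of_nonneg_left h5 (by positivity : 0 ≤ K * α)
    linarith

end Recursion

/-! ### The Markov property of a trajectory -/

section FiniteValued

variable {Ω T : Type*} [MeasurableSpace Ω] [Fintype T] {μ : Measure Ω}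

theorem integrable_comp_of_finite [IsFiniteMeasure μ] {Y : Ω → T}
    (hY : ∀ y, MeasurableSet {ω | Y ω = y}) (f : T → ℝ) : Integrable (fun ω => f (Y ω)) μ := by
  let : MeasurableSpace T := ⊤
  have hYm : Measurable Y := measurable_to_countable' hY
  exact (Integrable.of_finite (μ := μ.map Y) (f := f)).comp_measurable hYm

theorem integral_comp_eq_sum [IsFiniteMeasure μ] {Y : Ω → T}
    (hY : ∀ y, MeasurableSet {ω | Y ω = y}) (f : T → ℝ) :
    ∫ ω, f (Y ω) ∂μ = ∑ y, μ.real {ω | Y ω = y} * f y := by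
  let : MeasurableSpace T := ⊤
  have hYm : Measurable Y := measurable_to_countable' hY
  have h := integral_map (μ := μ) hYm.aemeasurable (f := f)
    (measurable_of_finite f).aestronglyMeasurable
  rw [← h, integral_fintype Integrable.of_finite]
  refine Finset.sum_congr rfl fun y _ => ?_
  rw [map_measureReal_apply hYm (measurableSet_singleton y)]
  rfl

end FiniteValued

/-- A path functional that is determined by the states up to time `t` and the actions before
time `t`. -/
def DependsUpTo {S A β : Type*} (t : ℕ) (F : (ℕ → S) → (ℕ → A) → β) : Prop :=
  ∀ s s' a a', (∀ i ≤ t, s i = s' i) → (∀ i < t, a i = a' i) → F s a = F s' a'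

section History

variable {S A Ω : Type*}

/-- The history up to time `t`, as a random variable with values in a finite type. -/
def history (X : ℕ → Ω → S) (U : ℕ → Ω → A) (t : ℕ) (ω : Ω) : (Fin (t + 1) → S) × (Fin t → A) :=
  (fun i => X i ω, fun i => U i ω)

theorem history_eq_iff {X : ℕ → Ω → S} {U : ℕ → Ω → A} (t : ℕ) (s : ℕ → S) (a : ℕ → A) (ω : Ω) :
    history X U t ω = (fun i : Fin (t + 1) => s i, fun i : Fin t => a i) ↔
      (∀ i ≤ t, X i ω = s i) ∧ ∀ i < t, U i ω = a i := by
  simp only [history, Prod.mk.injEq, funext_iff, Fin.forall_iff, Nat.lt_succ_iff]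

theorem exists_extension (S A : Type*) [Nonempty S] [Nonempty A] (t : ℕ) :
    ∃ (es : (Fin (t + 1) → S) × (Fin t → A) → ℕ → S)
      (ea : (Fin (t + 1) → S) × (Fin t → A) → ℕ → A),
      ∀ h, h = (fun i : Fin (t + 1) => es h i, fun i : Fin t => ea h i) := by
  classical
  refine ⟨fun h i => if hi : i < t + 1 then h.1 ⟨i, hi⟩ else Classical.arbitrary S,
    fun h i => if hi : i < t then h.2 ⟨i, hi⟩ else Classical.arbitrary A, fun h => ?_⟩
  ext i
  · simp [i.2]
  · simp

end History

namespace MDP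

variable {S A : Type*} [Fintype S] [Fintype A] {M : MDP S A} {π : Policy S A}

theorem nonempty_state (M : MDP S A) : Nonempty S := by
  by_contra h
  rw [not_nonempty_iff] at h
  simpa using M.p₀_mem.2

theorem nonempty_action (M : MDP S A) (π : Policy S A) : Nonempty A := by
  by_contra h
  rw [not_nonempty_iff] at h
  simpa using (π.prob_mem M.nonempty_state.some).2

namespace IsTrajectory

variable {Ω : Type*} [MeasurableSpace Ω] {μ : Measure Ω} {X : ℕ → Ω → S} {U : ℕ → Ω → A}

theorem law_succ (h : M.IsTrajectory π μ X U) (t : ℕ) (s : ℕ → S) (a : ℕ → A) (b : A) (s' : S) :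
    μ.real {ω | ((∀ i ≤ t, X i ω = s i) ∧ ∀ i < t, U i ω = a i) ∧ U t ω = b ∧ X (t + 1) ω = s'} =
      μ.real {ω | (∀ i ≤ t, X i ω = s i) ∧ ∀ i < t, U i ω = a i} *
        (π.prob (s t) b * M.p (s t) b s') := by
  classical
  have hs : ∀ i ≤ t, Function.update s (t + 1) s' i = s i := fun i hi =>
    Function.update_of_ne (by omega) _ _
  have ha : ∀ i < t, Function.update a t b i = a i := fun i hi =>
    Function.update_of_ne (by omega) _ _
  have h1 := h.law (t + 1) (Function.update s (t + 1) s') (Function.update a t b)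
  rw [h.law t s a, mul_assoc]
  rw [Finset.prod_range_succ, Finset.prod_congr rfl fun i hi => by
    rw [hs i (Finset.mem_range.1 hi).le, hs (i + 1) (Finset.mem_range.1 hi),
      ha i (Finset.mem_range.1 hi)], hs 0 (Nat.zero_le t), hs t le_rfl, Function.update_self,
    Function.update_self] at h1
  rw [← h1]
  congr 1
  ext ω
  constructor
  · rintro ⟨⟨h2, h3⟩, h4, h5⟩
    refine ⟨fun i hi => ?_, fun i hi => ?_⟩
    · rcases Nat.le_succ_iff.1 hi with hi | rfl
      · rw [hs i hi, h2 i hi]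
      · rw [Function.update_self, h5]
    · rcases Nat.lt_succ_iff_lt_or_eq.1 hi with hi | rfl
      · rw [ha i hi, h3 i hi]
      · rw [Function.update_self, h4]
  · rintro ⟨h2, h3⟩
    refine ⟨⟨fun i hi => ?_, fun i hi => ?_⟩, ?_, ?_⟩
    · rw [h2 i (by omega), hs i hi]
    · rw [h3 i (by omega), ha i hi]
    · rw [h3 t (by omega), Function.update_self]
    · rw [h2 (t + 1) le_rfl, Function.update_self]

theorem measurableSet_history (h : M.IsTrajectory π μ X U) (t : ℕ)
    (y : (Fin (t + 1) → S) × (Fin t → A)) : MeasurableSet {ω | history X U t ω = y} := by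
  have e : {ω | history X U t ω = y} =
      (⋂ i : Fin (t + 1), {ω | X i ω = y.1 i}) ∩ ⋂ i : Fin t, {ω | U i ω = y.2 i} := by
    ext ω
    simp [history, Prod.ext_iff, funext_iff]
  rw [e]
  exact (MeasurableSet.iInter fun i : Fin (t + 1) => h.measurable_state i (y.1 i)).inter
    (MeasurableSet.iInter fun i : Fin t => h.measurable_action i (y.2 i))

theorem integrable [IsFiniteMeasure μ] (h : M.IsTrajectory π μ X U) {t : ℕ}
    {F : (ℕ → S) → (ℕ → A) → ℝ} (hF : DependsUpTo t F) :
    Integrable (fun ω => F (fun n => X n ω) (fun n => U n ω)) μ := by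
  have := M.nonempty_state
  have := M.nonempty_action π
  classical
  obtain ⟨es, ea, he⟩ := exists_extension S A t
  have hi := integrable_comp_of_finite (μ := μ) (h.measurableSet_history t) fun y => F (es y) (ea y)
  refine hi.congr (Filter.Eventually.of_forall fun ω => ?_)
  have h1 := (history_eq_iff t _ _ ω).1 (he (history X U t ω))
  exact hF _ _ _ _ (fun i hi => (h1.1 i hi).symm) fun i hi => (h1.2 i hi).symm

/-- The Markov property: given the history up to time `t`, the pair of the next action and the next
state is distributed as `π (b | X_t) p (s' | X_t, b)`. -/
theorem integral_step [IsFiniteMeasure μ] (h : M.IsTrajectory π μ X U) {t : ℕ}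
    {H : (ℕ → S) → (ℕ → A) → A → S → ℝ} (hH : DependsUpTo t H) :
    ∫ ω, H (fun n => X n ω) (fun n => U n ω) (U t ω) (X (t + 1) ω) ∂μ =
      ∫ ω, ∑ b, ∑ s', π.prob (X t ω) b * M.p (X t ω) b s' *
        H (fun n => X n ω) (fun n => U n ω) b s' ∂μ := by
  have := M.nonempty_state
  have := M.nonempty_action π
  classical
  obtain ⟨es, ea, he⟩ := exists_extension S A t
  have hpath := fun ω => (history_eq_iff t _ _ ω).1 (he (history X U t ω))
  have hHω : ∀ ω, H (fun n => X n ω) (fun n => U n ω) =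
      H (es (history X U t ω)) (ea (history X U t ω)) := fun ω =>
    hH _ _ _ _ (hpath ω).1 (hpath ω).2
  have hXω : ∀ ω, X t ω = es (history X U t ω) t := fun ω => (hpath ω).1 t le_rfl
  let Y : Ω → ((Fin (t + 1) → S) × (Fin t → A)) × A × S := fun ω =>
    (history X U t ω, U t ω, X (t + 1) ω)
  have hYset : ∀ y, {ω | Y ω = y} =
      {ω | history X U t ω = y.1} ∩ ({ω | U t ω = y.2.1} ∩ {ω | X (t + 1) ω = y.2.2}) := by
    intro y
    ext ω
    simp [Y, Prod.ext_iff]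
  have hY : ∀ y, MeasurableSet {ω | Y ω = y} := fun y => by
    rw [hYset]
    exact (h.measurableSet_history t _).inter
      ((h.measurable_action _ _).inter (h.measurable_state _ _))
  have h1 := integral_comp_eq_sum (μ := μ) hY fun y => H (es y.1) (ea y.1) y.2.1 y.2.2
  have h2 := integral_comp_eq_sum (μ := μ) (h.measurableSet_history t) fun y =>
    ∑ b, ∑ s', π.prob (es y t) b * M.p (es y t) b s' * H (es y) (ea y) b s'
  have e1 : ∀ ω, H (fun n => X n ω) (fun n => U n ω) (U t ω) (X (t + 1) ω) =
      H (es (Y ω).1) (ea (Y ω).1) (Y ω).2.1 (Y ω).2.2 := fun ω => by rw [hHω]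
  have e2 : ∀ ω, (∑ b, ∑ s', π.prob (X t ω) b * M.p (X t ω) b s' *
      H (fun n => X n ω) (fun n => U n ω) b s') =
      ∑ b, ∑ s', π.prob (es (history X U t ω) t) b * M.p (es (history X U t ω) t) b s' *
        H (es (history X U t ω)) (ea (history X U t ω)) b s' := fun ω => by
    rw [← hXω]
    simp only [hHω ω]
  simp only [e1, e2]
  rw [h1, h2, Fintype.sum_prod_type]
  refine Finset.sum_congr rfl fun y _ => ?_
  rw [Fintype.sum_prod_type, Finset.mul_sum]
  refine Finset.sum_congr rfl fun b _ => ?_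
  rw [Finset.mul_sum]
  refine Finset.sum_congr rfl fun s' _ => ?_
  have h3 := h.law_succ t (es y) (ea y) b s'
  simp only [← history_eq_iff] at h3
  rw [← he y] at h3
  rw [hYset, ← mul_assoc, ← h3]
  rfl

end IsTrajectory

end MDP

/-! ### The mean dynamics -/

section NegativeDefinite

variable {d : ℕ} {B : Matrix (Fin d) (Fin d) ℝ}

/-- By compactness of the unit sphere of `ker(B)ᗮ`. -/
theorem Matrix.exists_negDefOnKerPerp
    (h : ∀ w, Matrix.toEuclideanLin B w ≠ 0 → inner ℝ w (Matrix.toEuclideanLin B w) < 0) :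
    ∃ c : ℝ, 0 < c ∧ B.NegDefOnKerPerp c := by
  set V := (LinearMap.ker (Matrix.toEuclideanLin B))ᗮ with hV
  have hcont : Continuous fun w => inner ℝ w (Matrix.toEuclideanLin B w) :=
    continuous_id.inner (Matrix.toEuclideanLin B).continuous_of_finiteDimensional
  have hcomp : IsCompact (Metric.sphere (0 : EuclideanSpace ℝ (Fin d)) 1 ∩ (V : Set _)) :=
    (isCompact_sphere 0 1).inter_right V.closed_of_finiteDimensional
  have hmem : ∀ w ∈ V, w ≠ 0 → ‖w‖⁻¹ • w ∈ Metric.sphere (0 : EuclideanSpace ℝ (Fin d)) 1 ∩ V := by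
    intro w hw hw0
    refine ⟨?_, V.smul_mem _ hw⟩
    rw [mem_sphere_zero_iff_norm, norm_smul, norm_inv, norm_norm,
      inv_mul_cancel₀ (norm_ne_zero_iff.2 hw0)]
  rcases (Metric.sphere (0 : EuclideanSpace ℝ (Fin d)) 1 ∩ (V : Set _)).eq_empty_or_nonempty
    with hemp | hne
  · refine ⟨1, one_pos, fun w hw => ?_⟩
    have : w = 0 := by
      by_contra hw0
      have := hmem w hw hw0
      rw [hemp] at this
      exact this
    simp [this]
  · obtain ⟨v, hv, hmax⟩ := hcomp.exists_isMaxOn hne hcont.continuousOn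
    have hv0 : v ≠ 0 := by
      rintro rfl
      simpa using hv.1
    refine ⟨-inner ℝ v (Matrix.toEuclideanLin B v), ?_, fun w hw => ?_⟩
    · refine neg_pos.2 (h v fun hker => hv0 ?_)
      exact inner_self_eq_zero.1 ((Submodule.mem_orthogonal _ v).1 hv.2 v hker)
    · by_cases hw0 : w = 0
      · simp [hw0]
      · have h1 : inner ℝ (‖w‖⁻¹ • w) (Matrix.toEuclideanLin B (‖w‖⁻¹ • w)) ≤
            inner ℝ v (Matrix.toEuclideanLin B v) := hmax (hmem w hw hw0)
        rw [map_smul, real_inner_smul_left, real_inner_smul_right] at h1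
        have h2 : 0 < ‖w‖ := norm_pos_iff.2 hw0
        have h3 := mul_le_mul_of_nonneg_right h1 (sq_nonneg ‖w‖)
        field_simp at h3
        linarith

/-- If the range of `B` is orthogonal to its kernel, the two dimensions force it to be all of
`ker(B)ᗮ`. -/
theorem Matrix.range_toEuclideanLin_eq_ker_orthogonal
    (h : ∀ u, Matrix.toEuclideanLin B u = 0 → ∀ v, inner ℝ u (Matrix.toEuclideanLin B v) = 0) :
    LinearMap.range (Matrix.toEuclideanLin B) = (LinearMap.ker (Matrix.toEuclideanLin B))ᗮ := by
  refine Submodule.eq_of_le_of_finrank_eq ?_ ?_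
  · rintro _ ⟨v, rfl⟩
    exact (Submodule.mem_orthogonal _ _).2 fun u hu => h u hu v
  · have h1 := LinearMap.finrank_range_add_finrank_ker (Matrix.toEuclideanLin B)
    have h2 := Submodule.finrank_add_finrank_orthogonal (LinearMap.ker (Matrix.toEuclideanLin B))
    omega

end NegativeDefinite

namespace MDP

variable {S A : Type*} [Fintype S] [DecidableEq S] [Fintype A] (M : MDP S A) (π : Policy S A)
  (γ lam : ℝ) {d : ℕ} (x : S → EuclideanSpace ℝ (Fin d))

open Matrix

/-- The expected temporal-difference error in state `s` under the parameter `v`. -/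
noncomputable def meanError (v : EuclideanSpace ℝ (Fin d)) (s : S) : ℝ :=
  M.rPi π s + γ * ∑ s', M.transMatrix π s s' * inner ℝ (x s') v - inner ℝ (x s) v

/-- The `γ λ`-discounted sum of the expected temporal-difference errors along the chain,
`(1 - γ λ P_π)⁻¹` applied to `meanError`. -/
noncomputable def errorSum (v : EuclideanSpace ℝ (Fin d)) : S → ℝ :=
  (1 - (γ * lam) • M.transMatrix π)⁻¹ *ᵥ M.meanError π γ x v

variable {γ lam}

theorem isUnit_det_resolvent (hγ0 : 0 ≤ γ) (hγ1 : γ < 1) (hlam0 : 0 ≤ lam) (hlam1 : lam ≤ 1) :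
    IsUnit (1 - (γ * lam) • M.transMatrix π).det :=
  isUnit_det_one_sub_smul (M.transMatrix_nonneg π) (M.transMatrix_row_sum π)
    (mul_nonneg hγ0 hlam0) (by nlinarith)

variable {M π x}

omit [Fintype S] [DecidableEq S] in
theorem featMatrix_mulVec (v : EuclideanSpace ℝ (Fin d)) (s : S) :
    (featMatrix x *ᵥ v.ofLp) s = inner ℝ (x s) v := by
  simp [mulVec, dotProduct, featMatrix, PiLp.inner_apply, mul_comm]

theorem meanError_eq (v : EuclideanSpace ℝ (Fin d)) :
    M.meanError π γ x v =
      M.rPi π + (γ • M.transMatrix π - 1) *ᵥ (featMatrix x *ᵥ v.ofLp) := by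
  ext s
  rw [Pi.add_apply, sub_mulVec, smul_mulVec, one_mulVec]
  simp only [meanError, Pi.sub_apply, Pi.smul_apply, featMatrix_mulVec, smul_eq_mul]
  rw [← add_sub_assoc]
  congr 3
  simp only [mulVec, dotProduct]
  refine Finset.sum_congr rfl fun s' _ => ?_
  congr 1
  exact (featMatrix_mulVec v s').symm

theorem errorSum_sub (hdet : IsUnit (1 - (γ * lam) • M.transMatrix π).det)
    (v : EuclideanSpace ℝ (Fin d)) (s : S) :
    M.errorSum π γ lam x v s - γ * lam * ∑ s', M.transMatrix π s s' * M.errorSum π γ lam x v s' =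
      M.meanError π γ x v s := by
  have h : (1 - (γ * lam) • M.transMatrix π) *ᵥ M.errorSum π γ lam x v =
      M.meanError π γ x v := by
    rw [errorSum, mulVec_mulVec, mul_nonsing_inv _ hdet, one_mulVec]
  have h := congrFun h s
  rw [sub_mulVec, one_mulVec, smul_mulVec] at h
  exact h

theorem smul_PLam_sub_one (hdet : IsUnit (1 - (γ * lam) • M.transMatrix π).det) :
    γ • M.PLam π γ lam - 1 =
      (1 - (γ * lam) • M.transMatrix π)⁻¹ * (γ • M.transMatrix π - 1) := by
  have h := nonsing_inv_mul _ hdet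
  rw [mul_sub, mul_one, mul_smul_comm, PLam, smul_smul]
  rw [mul_sub, mul_one, mul_smul_comm] at h
  nth_rewrite 2 [← h]
  module

/-- The stationary mean of the update direction `x(s) · errorSum` at `v` is `A v + b`. -/
theorem sum_statDist_mul_errorSum (hdet : IsUnit (1 - (γ * lam) • M.transMatrix π).det)
    (u v : EuclideanSpace ℝ (Fin d)) :
    ∑ s, M.statDist π s * (inner ℝ u (x s) * M.errorSum π γ lam x v s) =
      inner ℝ u (toEuclideanLin (M.tdA π γ lam x) v) +
        inner ℝ u (WithLp.toLp 2 (M.tdb π γ lam x)) := by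
  have h1 : M.tdA π γ lam x *ᵥ v.ofLp + M.tdb π γ lam x =
      ((featMatrix x).transpose * diagonal (M.statDist π)) *ᵥ M.errorSum π γ lam x v := by
    rw [tdA, smul_PLam_sub_one hdet, tdb, rLam, errorSum, meanError_eq, mulVec_add, mulVec_add,
      add_comm]
    simp only [mulVec_mulVec, Matrix.mul_assoc]
  have h2 : toEuclideanLin (M.tdA π γ lam x) v + WithLp.toLp 2 (M.tdb π γ lam x) =
      WithLp.toLp 2 (((featMatrix x).transpose * diagonal (M.statDist π)) *ᵥ
        M.errorSum π γ lam x v) := by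
    rw [← h1]; rfl
  rw [← inner_add_right, h2]
  have h3 : inner ℝ u (WithLp.toLp 2 (((featMatrix x).transpose * diagonal (M.statDist π)) *ᵥ
      M.errorSum π γ lam x v)) = u.ofLp ⬝ᵥ (((featMatrix x).transpose *
        diagonal (M.statDist π)) *ᵥ M.errorSum π γ lam x v) := by
    simp [PiLp.inner_apply, dotProduct, mul_comm]
  rw [h3, ← mulVec_mulVec, dotProduct_mulVec, vecMul_transpose]
  simp only [dotProduct, mulVec_diagonal, featMatrix_mulVec]
  refine Finset.sum_congr rfl fun s _ => ?_
  rw [real_inner_comm]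
  ring

/-- The quadratic form of `A`, in terms of `z = (1 - γ λ P_π)⁻¹ X w`. -/
theorem inner_tdA (hdet : IsUnit (1 - (γ * lam) • M.transMatrix π).det)
    (w : EuclideanSpace ℝ (Fin d)) :
    ∃ z : S → ℝ, (∀ s, inner ℝ (x s) w = z s - γ * lam * (M.transMatrix π *ᵥ z) s) ∧
      inner ℝ w (toEuclideanLin (M.tdA π γ lam x) w) =
        ∑ s, M.statDist π s * ((z s - γ * lam * (M.transMatrix π *ᵥ z) s) *
          (γ * (M.transMatrix π *ᵥ z) s - z s)) := by
  set P := M.transMatrix π with hP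
  set z := (1 - (γ * lam) • P)⁻¹ *ᵥ (featMatrix x *ᵥ w.ofLp) with hz
  have h1 : (1 - (γ * lam) • P) *ᵥ z = featMatrix x *ᵥ w.ofLp := by
    rw [hz, mulVec_mulVec, mul_nonsing_inv _ hdet, one_mulVec]
  have h2 : ∀ s, inner ℝ (x s) w = z s - γ * lam * (P *ᵥ z) s := fun s => by
    rw [← featMatrix_mulVec, ← h1, sub_mulVec, one_mulVec, smul_mulVec]
    rfl
  refine ⟨z, h2, ?_⟩
  have h3 : (1 - (γ * lam) • P)⁻¹ *ᵥ ((γ • P - 1) *ᵥ (featMatrix x *ᵥ w.ofLp)) =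
      (γ • P - 1) *ᵥ z := by
    have hcomm : (γ • P - 1) * (1 - (γ * lam) • P) = (1 - (γ * lam) • P) * (γ • P - 1) := by
      simp only [mul_sub, sub_mul, mul_one, one_mul, mul_smul_comm, smul_mul_assoc]
      module
    rw [← h1, mulVec_mulVec z (γ • P - 1), hcomm, ← mulVec_mulVec, mulVec_mulVec, nonsing_inv_mul _ hdet,
      one_mulVec]
  have h4 := sum_statDist_mul_errorSum (x := x) hdet w w
  have h5 := sum_statDist_mul_errorSum (x := x) hdet w 0
  rw [map_zero, inner_zero_right, zero_add] at h5
  rw [← h5] at h4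
  have h6 : inner ℝ w (toEuclideanLin (M.tdA π γ lam x) w) =
      ∑ s, M.statDist π s * (inner ℝ w (x s) * M.errorSum π γ lam x w s) -
      ∑ s, M.statDist π s * (inner ℝ w (x s) * M.errorSum π γ lam x 0 s) := by linarith
  rw [h6, ← Finset.sum_sub_distrib]
  refine Finset.sum_congr rfl fun s _ => ?_
  have h7 : M.errorSum π γ lam x w s - M.errorSum π γ lam x 0 s = ((γ • P - 1) *ᵥ z) s := by
    rw [← h3, errorSum, errorSum, meanError_eq, meanError_eq, mulVec_add, mulVec_add]
    simp [← hP]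
  rw [sub_mulVec, one_mulVec, smul_mulVec] at h7
  simp only [Pi.sub_apply, Pi.smul_apply, smul_eq_mul] at h7
  rw [real_inner_comm, ← h2, ← h7]
  ring

section Irreducible

variable (hirr : (M.transMatrix π).IsIrreducible) (hγ0 : 0 ≤ γ) (hγ1 : γ < 1) (hlam0 : 0 ≤ lam)
  (hlam1 : lam ≤ 1)

include hirr hγ0 hγ1 hlam0 hlam1

theorem inner_tdA_neg_of_inner_ne_zero {w : EuclideanSpace ℝ (Fin d)}
    {s : S} (hs : inner ℝ (x s) w ≠ 0) :
    inner ℝ w (toEuclideanLin (M.tdA π γ lam x) w) < 0 := by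
  obtain ⟨z, hz, hA⟩ := inner_tdA (x := x) (M.isUnit_det_resolvent π hγ0 hγ1 hlam0 hlam1) w
  have hstat := M.statDist_spec π
  have hβ0 : 0 ≤ γ * lam := mul_nonneg hγ0 hlam0
  have hβ1 : γ * lam < 1 := by nlinarith
  rw [hA]
  refine (sum_stationary_resolvent_form_le (M.transMatrix_nonneg π) (M.transMatrix_row_sum π)
    hstat.1.1 hstat.2 hγ0 hγ1.le hβ0 hβ1.le z).trans_lt ?_
  have hpos : 0 < ∑ s, M.statDist π s * z s ^ 2 := by
    refine lt_of_le_of_ne (Finset.sum_nonneg fun i _ => mul_nonneg (hstat.1.1 i) (sq_nonneg _)) ?_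
    intro h0
    have h1 := (Finset.sum_eq_zero_iff_of_nonneg fun i _ =>
      mul_nonneg (hstat.1.1 i) (sq_nonneg (z i))).1 h0.symm
    have h2 : z = 0 := by
      ext i
      have := h1 i (Finset.mem_univ i)
      have hi := stationary_pos hirr hstat.1 hstat.2 i
      simpa [hi.ne'] using this
    apply hs
    rw [hz s, h2]
    simp
  have : 0 < (1 - γ) * (1 - γ * lam) := mul_pos (by linarith) (by linarith)
  nlinarith

/-- `ker A = ker X`. -/
theorem toEuclideanLin_tdA_eq_zero_iff {w : EuclideanSpace ℝ (Fin d)} :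
    toEuclideanLin (M.tdA π γ lam x) w = 0 ↔ ∀ s, inner ℝ (x s) w = 0 := by
  constructor
  · intro h s
    by_contra hs
    have := inner_tdA_neg_of_inner_ne_zero hirr hγ0 hγ1 hlam0 hlam1 hs
    rw [h, inner_zero_right] at this
    exact lt_irrefl _ this
  · intro h
    have h1 : featMatrix x *ᵥ w.ofLp = 0 := by
      ext s
      rw [featMatrix_mulVec, h s, Pi.zero_apply]
    have h2 : M.tdA π γ lam x *ᵥ w.ofLp = 0 := by
      rw [tdA, ← mulVec_mulVec, h1, mulVec_zero]
    exact congrArg (WithLp.toLp 2) h2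

theorem feature_mem_ker_orthogonal (s : S) :
    x s ∈ (LinearMap.ker (toEuclideanLin (M.tdA π γ lam x)))ᗮ := by
  refine (Submodule.mem_orthogonal _ _).2 fun u hu => ?_
  rw [real_inner_comm]
  exact (toEuclideanLin_tdA_eq_zero_iff hirr hγ0 hγ1 hlam0 hlam1).1 hu s

theorem exists_negDefOnKerPerp_tdA :
    ∃ c : ℝ, 0 < c ∧ (M.tdA π γ lam x).NegDefOnKerPerp c := by
  refine exists_negDefOnKerPerp fun w hw => ?_
  rw [Ne, toEuclideanLin_tdA_eq_zero_iff hirr hγ0 hγ1 hlam0 hlam1] at hw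
  push Not at hw
  obtain ⟨s, hs⟩ := hw
  exact inner_tdA_neg_of_inner_ne_zero hirr hγ0 hγ1 hlam0 hlam1 hs

omit hirr hγ0 hγ1 hlam0 hlam1 in
theorem mem_solSet_iff {w : EuclideanSpace ℝ (Fin d)} :
    w ∈ M.solSet π γ lam x ↔
      toEuclideanLin (M.tdA π γ lam x) w + WithLp.toLp 2 (M.tdb π γ lam x) = 0 := by
  constructor
  · intro h
    exact congrArg (WithLp.toLp 2) h
  · intro h
    exact congrArg WithLp.ofLp h

theorem solSet_nonempty : (M.solSet π γ lam x).Nonempty := by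
  have hdet := M.isUnit_det_resolvent π hγ0 hγ1 hlam0 hlam1
  have hz : ∀ u, toEuclideanLin (M.tdA π γ lam x) u = 0 → ∀ v,
      inner ℝ u (toEuclideanLin (M.tdA π γ lam x) v) +
        inner ℝ u (WithLp.toLp 2 (M.tdb π γ lam x)) = 0 := by
    intro u hu v
    rw [← sum_statDist_mul_errorSum hdet]
    refine Finset.sum_eq_zero fun s _ => ?_
    rw [real_inner_comm, (toEuclideanLin_tdA_eq_zero_iff hirr hγ0 hγ1 hlam0 hlam1).1 hu s]
    ring
  have hb : ∀ u, toEuclideanLin (M.tdA π γ lam x) u = 0 →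
      inner ℝ u (WithLp.toLp 2 (M.tdb π γ lam x)) = 0 := fun u hu => by
    simpa using hz u hu 0
  have hrange := range_toEuclideanLin_eq_ker_orthogonal (B := M.tdA π γ lam x) fun u hu v => by
    simpa [hb u hu] using hz u hu v
  have hmem : -WithLp.toLp 2 (M.tdb π γ lam x) ∈
      LinearMap.range (toEuclideanLin (M.tdA π γ lam x)) := by
    rw [hrange]
    refine Submodule.neg_mem _ ((Submodule.mem_orthogonal _ _).2 fun u hu => hb u hu)
  obtain ⟨w, hw⟩ := hmem
  exact ⟨w, mem_solSet_iff.2 (by rw [hw]; exact neg_add_cancel _)⟩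

end Irreducible

/-- `W_*` is a translate of `ker A`, so the distance to it is the norm of the component along
`ker(A)ᗮ`. -/
theorem infDist_solSet {wstar : EuclideanSpace ℝ (Fin d)} (hw : wstar ∈ M.solSet π γ lam x)
    (w : EuclideanSpace ℝ (Fin d)) :
    Metric.infDist w (M.solSet π γ lam x) =
      ‖(LinearMap.ker (toEuclideanLin (M.tdA π γ lam x)))ᗮ.starProjection (w - wstar)‖ := by
  set K := LinearMap.ker (toEuclideanLin (M.tdA π γ lam x)) with hK
  have hiff : ∀ y, y ∈ M.solSet π γ lam x ↔ y - wstar ∈ K := by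
    intro y
    have h1 := mem_solSet_iff.1 hw
    rw [mem_solSet_iff, hK, LinearMap.mem_ker, map_sub, eq_neg_of_add_eq_zero_left h1,
      sub_neg_eq_add]
  refine le_antisymm ?_ ?_
  · have h1 : w - Kᗮ.starProjection (w - wstar) ∈ M.solSet π γ lam x := by
      rw [hiff]
      have h2 := Kᗮ.sub_starProjection_mem_orthogonal (w - wstar)
      rw [Submodule.orthogonal_orthogonal] at h2
      convert h2 using 1
      abel
    refine (Metric.infDist_le_dist_of_mem h1).trans (le_of_eq ?_)
    rw [dist_eq_norm, sub_sub_cancel]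
  · refine (Metric.le_infDist ⟨wstar, hw⟩).2 fun y hy => ?_
    have h1 : Kᗮ.starProjection (y - wstar) = 0 := by
      rw [Submodule.starProjection_apply_eq_zero_iff, Submodule.orthogonal_orthogonal]
      exact (hiff y).1 hy
    have h2 : Kᗮ.starProjection (w - wstar) = Kᗮ.starProjection (w - y) := by
      rw [← sub_add_sub_cancel w y wstar, map_add, h1, add_zero]
    rw [h2, dist_eq_norm]
    exact Kᗮ.norm_starProjection_apply_le _

end MDP

/-! ### The Poisson function of the TD(λ) update -/

namespace MDP

variable {S A : Type*} [Fintype S] [DecidableEq S] [Fintype A] {M : MDP S A} {π : Policy S A}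
  {γ lam : ℝ} {d : ℕ} {x : S → EuclideanSpace ℝ (Fin d)}

variable (M π γ lam x) in
theorem exists_errorSum_affine : ∃ (φ : S → EuclideanSpace ℝ (Fin d)) (η : S → ℝ),
    ∀ v s, M.errorSum π γ lam x v s = inner ℝ (φ s) v + η s := by
  set G := (1 - (γ * lam) • M.transMatrix π)⁻¹ with hG
  refine ⟨fun s => ∑ i, G s i • (γ • ∑ j, M.transMatrix π i j • x j - x i),
    fun s => ∑ i, G s i * M.rPi π i, fun v s => ?_⟩
  simp only [errorSum, Matrix.mulVec, dotProduct, ← hG, sum_inner, real_inner_smul_left,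
    inner_sub_left, ← Finset.sum_add_distrib]
  exact Finset.sum_congr rfl fun i _ => by rw [meanError]; ring

/-- The Poisson function of the Markov chain `(S_t, e_t)` for the increment of `‖u‖²` under the
TD(λ) update. The state `(s, e)` ranges over an infinite set, but the trace enters affinely, so
that a bilinear term in `(u, e)` reduces the Poisson equation to one on `S`, solved by the
kernel `Z`. -/
noncomputable def poissonFun (M : MDP S A) (π : Policy S A) (γ lam : ℝ)
    (x : S → EuclideanSpace ℝ (Fin d)) (wstar : EuclideanSpace ℝ (Fin d)) (Z : S → S → ℝ)
    (s : S) (e u : EuclideanSpace ℝ (Fin d)) : ℝ :=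
  inner ℝ u e * M.errorSum π γ lam x (u + wstar) s +
    ∑ i, Z s i * ∑ j, M.transMatrix π i j *
      (inner ℝ u (x j) * M.errorSum π γ lam x (u + wstar) j)

theorem poissonFun_zero (wstar : EuclideanSpace ℝ (Fin d)) (Z : S → S → ℝ) (s : S)
    (e : EuclideanSpace ℝ (Fin d)) : M.poissonFun π γ lam x wstar Z s e 0 = 0 := by
  simp [poissonFun]

/-- The Poisson equation: the mean increment at `(s, e)` is its stationary value `⟨u, A u⟩` plus
the expected decrease of `poissonFun` in one step of the chain with `u` frozen. -/
theorem inner_mul_meanError_eq (hdet : IsUnit (1 - (γ * lam) • M.transMatrix π).det)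
    {wstar : EuclideanSpace ℝ (Fin d)} (hw : wstar ∈ M.solSet π γ lam x) {Z : S → S → ℝ}
    (hZ : ∀ s i, Z s i - ∑ s', M.transMatrix π s s' * Z s' i =
      (if s = i then 1 else 0) - M.statDist π i)
    (s : S) (e u : EuclideanSpace ℝ (Fin d)) :
    inner ℝ u e * M.meanError π γ x (u + wstar) s =
      inner ℝ u (Matrix.toEuclideanLin (M.tdA π γ lam x) u) +
        M.poissonFun π γ lam x wstar Z s e u -
        ∑ s', M.transMatrix π s s' *
          M.poissonFun π γ lam x wstar Z s' ((γ * lam) • e + x s') u := by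
  set P := M.transMatrix π with hP
  set ζ := M.errorSum π γ lam x (u + wstar) with hζ
  set m : S → ℝ := fun j => inner ℝ u (x j) * ζ j with hm
  set f : S → ℝ := fun i => ∑ j, P i j * m j with hf
  have hmean : ∑ i, M.statDist π i * f i =
      inner ℝ u (Matrix.toEuclideanLin (M.tdA π γ lam x) u) := by
    have h1 := sum_statDist_mul_errorSum (x := x) hdet u (u + wstar)
    have h2 : ∑ i, M.statDist π i * f i = ∑ i, M.statDist π i * m i :=
      sum_stationary_mulVec (M.statDist_spec π).2 m
    rw [h2]
    simp only [hm, hζ]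
    rw [h1, ← inner_add_right, map_add, add_assoc, mem_solSet_iff.1 hw, add_zero]
  have hψ : ∑ i, Z s i * f i - ∑ s', P s s' * ∑ i, Z s' i * f i =
      f s - inner ℝ u (Matrix.toEuclideanLin (M.tdA π γ lam x) u) := by
    rw [← hmean]
    have h1 : ∑ s', P s s' * ∑ i, Z s' i * f i = ∑ i, (∑ s', P s s' * Z s' i) * f i := by
      simp only [Finset.mul_sum, Finset.sum_mul]
      rw [Finset.sum_comm]
      exact Finset.sum_congr rfl fun i _ => Finset.sum_congr rfl fun j _ => by ring
    rw [h1, ← Finset.sum_sub_distrib]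
    simp only [← sub_mul, hZ]
    simp only [sub_mul, Finset.sum_sub_distrib, ite_mul, one_mul, zero_mul, Finset.sum_ite_eq,
      Finset.mem_univ, if_true]
  have hnext : ∑ s', P s s' * M.poissonFun π γ lam x wstar Z s' ((γ * lam) • e + x s') u =
      inner ℝ u e * (γ * lam * ∑ s', P s s' * ζ s') + f s +
        ∑ s', P s s' * ∑ i, Z s' i * f i := by
    simp only [hf, Finset.mul_sum, ← Finset.sum_add_distrib]
    refine Finset.sum_congr rfl fun s' _ => ?_
    simp only [poissonFun, inner_add_right, real_inner_smul_right, ← hP, ← hζ, hm,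
      ← Finset.mul_sum]
    ring
  have hcur : M.poissonFun π γ lam x wstar Z s e u = inner ℝ u e * ζ s + ∑ i, Z s i * f i := rfl
  rw [hnext, hcur, ← errorSum_sub hdet]
  linarith

theorem abs_poissonFun_sub_le (wstar : EuclideanSpace ℝ (Fin d)) (Z : S → S → ℝ) {R : ℝ}
    (hR : ∀ s, ‖x s‖ ≤ R) :
    ∃ K : ℝ, 0 ≤ K ∧ ∀ s e, ‖e‖ ≤ R → ∀ u v,
      |M.poissonFun π γ lam x wstar Z s e u - M.poissonFun π γ lam x wstar Z s e v| ≤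
        K * (1 + ‖u‖ + ‖v‖) * ‖u - v‖ := by
  obtain ⟨φ, η, hζ⟩ := exists_errorSum_affine M π γ lam x
  set K₁ := ∑ s, (‖φ s‖ + |inner ℝ (φ s) wstar + η s|) with hK₁
  have hK₁0 : 0 ≤ K₁ := Finset.sum_nonneg fun s _ => by positivity
  have hle : ∀ s, ‖φ s‖ + |inner ℝ (φ s) wstar + η s| ≤ K₁ := fun s =>
    Finset.single_le_sum (f := fun s => ‖φ s‖ + |inner ℝ (φ s) wstar + η s|)
      (fun i _ => by positivity) (Finset.mem_univ s)
  have hR0 : 0 ≤ R := (norm_nonneg _).trans (hR M.nonempty_state.some)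
  have hprod : ∀ s e, ‖e‖ ≤ R → ∀ u v,
      |inner ℝ u e * M.errorSum π γ lam x (u + wstar) s -
        inner ℝ v e * M.errorSum π γ lam x (v + wstar) s| ≤
        R * K₁ * (1 + ‖u‖ + ‖v‖) * ‖u - v‖ := by
    intro s e he u v
    have h1 : |inner ℝ (u - v) e| ≤ ‖u - v‖ * R :=
      (abs_real_inner_le_norm _ _).trans (by gcongr)
    have h2 : |inner ℝ v e| ≤ ‖v‖ * R := (abs_real_inner_le_norm _ _).trans (by gcongr)
    have h3 : |M.errorSum π γ lam x (u + wstar) s| ≤ K₁ * (1 + ‖u‖) := by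
      rw [hζ, inner_add_right, add_assoc]
      refine (abs_add_le _ _).trans ?_
      have h4 := abs_real_inner_le_norm (φ s) u
      have h5 : ‖φ s‖ ≤ K₁ := (le_add_of_nonneg_right (abs_nonneg _)).trans (hle s)
      have h6 : |inner ℝ (φ s) wstar + η s| ≤ K₁ :=
        (le_add_of_nonneg_left (norm_nonneg _)).trans (hle s)
      have h7 := mul_le_mul_of_nonneg_right h5 (norm_nonneg u)
      linarith
    have h4 : |M.errorSum π γ lam x (u + wstar) s - M.errorSum π γ lam x (v + wstar) s| ≤
        K₁ * ‖u - v‖ := by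
      have e1 : M.errorSum π γ lam x (u + wstar) s - M.errorSum π γ lam x (v + wstar) s =
          inner ℝ (φ s) (u - v) := by
        rw [hζ, hζ, inner_add_right, inner_add_right, inner_sub_right]
        ring
      rw [e1]
      refine (abs_real_inner_le_norm _ _).trans ?_
      have h5 : ‖φ s‖ ≤ K₁ := (le_add_of_nonneg_right (abs_nonneg _)).trans (hle s)
      gcongr
    have e2 : inner ℝ u e * M.errorSum π γ lam x (u + wstar) s -
        inner ℝ v e * M.errorSum π γ lam x (v + wstar) s =
        inner ℝ (u - v) e * M.errorSum π γ lam x (u + wstar) s +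
        inner ℝ v e * (M.errorSum π γ lam x (u + wstar) s -
          M.errorSum π γ lam x (v + wstar) s) := by
      rw [inner_sub_left]; ring
    rw [e2]
    refine (abs_add_le _ _).trans ?_
    rw [abs_mul, abs_mul]
    calc _ ≤ ‖u - v‖ * R * (K₁ * (1 + ‖u‖)) + ‖v‖ * R * (K₁ * ‖u - v‖) := by gcongr
      _ = R * K₁ * (1 + ‖u‖ + ‖v‖) * ‖u - v‖ := by ring
  set K₂ := ∑ s, ∑ i, |Z s i| with hK₂
  have hK₂0 : 0 ≤ K₂ := Finset.sum_nonneg fun s _ => Finset.sum_nonneg fun i _ => abs_nonneg _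
  refine ⟨R * K₁ * (1 + K₂), by positivity, fun s e he u v => ?_⟩
  set L := R * K₁ * (1 + ‖u‖ + ‖v‖) * ‖u - v‖ with hL
  have hL0 : 0 ≤ L := by positivity
  have h1 := hprod s e he u v
  have h2 : |∑ i, Z s i * ∑ j, M.transMatrix π i j *
        (inner ℝ u (x j) * M.errorSum π γ lam x (u + wstar) j) -
      ∑ i, Z s i * ∑ j, M.transMatrix π i j *
        (inner ℝ v (x j) * M.errorSum π γ lam x (v + wstar) j)| ≤ K₂ * L := by
    have h3 : ∑ i, |Z s i| ≤ K₂ := Finset.single_le_sum (f := fun s => ∑ i, |Z s i|)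
      (fun s _ => Finset.sum_nonneg fun i _ => abs_nonneg _) (Finset.mem_univ s)
    refine le_trans ?_ (mul_le_mul_of_nonneg_right h3 hL0)
    rw [← Finset.sum_sub_distrib, Finset.sum_mul]
    refine (Finset.abs_sum_le_sum_abs _ _).trans (Finset.sum_le_sum fun i _ => ?_)
    rw [← mul_sub, abs_mul, ← Finset.sum_sub_distrib]
    refine mul_le_mul_of_nonneg_left ?_ (abs_nonneg _)
    calc _ ≤ ∑ j, M.transMatrix π i j * L := by
          refine (Finset.abs_sum_le_sum_abs _ _).trans (Finset.sum_le_sum fun j _ => ?_)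
          rw [← mul_sub, abs_mul, abs_of_nonneg (M.transMatrix_nonneg π i j)]
          exact mul_le_mul_of_nonneg_left (hprod j (x j) (hR j) u v) (M.transMatrix_nonneg π i j)
      _ = L := by rw [← Finset.sum_mul, M.transMatrix_row_sum π i, one_mul]
  have e1 : M.poissonFun π γ lam x wstar Z s e u - M.poissonFun π γ lam x wstar Z s e v =
      (inner ℝ u e * M.errorSum π γ lam x (u + wstar) s -
        inner ℝ v e * M.errorSum π γ lam x (v + wstar) s) +
      (∑ i, Z s i * ∑ j, M.transMatrix π i j *
        (inner ℝ u (x j) * M.errorSum π γ lam x (u + wstar) j) -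
      ∑ i, Z s i * ∑ j, M.transMatrix π i j *
        (inner ℝ v (x j) * M.errorSum π γ lam x (v + wstar) j)) := by
    simp only [poissonFun]; ring
  rw [e1]
  refine (abs_add_le _ _).trans ((add_le_add h1 h2).trans (le_of_eq ?_))
  rw [hL]; ring

end MDP

/-! ### One step of the Lyapunov function -/

section OneStep

variable {E : Type*} [NormedAddCommGroup E] [InnerProductSpace ℝ E]

/-- One step of linear stochastic approximation, `u ↦ u + a h` with an increment `h` of at most
linear growth: the corrected Lyapunov function `‖u‖² + 2 a q(u)`, for `q` of quadratic growth, is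
changed to first order in `a` only through `⟨u, h⟩` and `q`. -/
theorem exists_lyapunov_step_bound {α K K₂ K₃ : ℝ} (hα : 0 ≤ α) (hK : 0 ≤ K) (hK₂ : 0 ≤ K₂)
    (hK₃ : 0 ≤ K₃) :
    ∃ C R : ℝ, 0 ≤ C ∧ 1 ≤ R ∧ ∀ (q : E → ℝ) (u h : E) (a a' : ℝ), q 0 = 0 →
      (∀ u v, |q u - q v| ≤ K * (1 + ‖u‖ + ‖v‖) * ‖u - v‖) → ‖h‖ ≤ K₂ * (1 + ‖u‖) → 0 ≤ a →
      a ≤ α → 0 ≤ a - a' → a - a' ≤ K₃ * a ^ 2 →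
      1 + ‖u + a • h‖ ^ 2 ≤ R * (1 + ‖u‖ ^ 2) ∧
      ‖u + a • h‖ ^ 2 + 2 * a' * q (u + a • h) ≤
        ‖u‖ ^ 2 + 2 * a * (inner ℝ u h + q u) + C * a ^ 2 * (1 + ‖u‖ ^ 2) := by
  set R := 2 + 4 * α ^ 2 * K₂ ^ 2 with hR
  refine ⟨2 * K₂ ^ 2 + 4 * (K * (2 + α * K₂) * K₂) + 4 * K₃ * K * R, R, by positivity, by
    rw [hR]; nlinarith [sq_nonneg (α * K₂)], ?_⟩
  intro q u h a a' hq0 hq hh ha haα haa' haa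
  set n := ‖u‖ with hn
  have hn0 : 0 ≤ n := norm_nonneg u
  set v := u + a • h with hv
  have hn2 : (1 + n) ^ 2 ≤ 2 * (1 + n ^ 2) := by nlinarith [sq_nonneg (1 - n)]
  have hah : ‖v - u‖ ≤ a * (K₂ * (1 + n)) := by
    rw [hv, add_sub_cancel_left, norm_smul, Real.norm_of_nonneg ha]
    gcongr
  have hahα : ‖v - u‖ ≤ α * (K₂ * (1 + n)) := hah.trans (by gcongr)
  have hvn : ‖v‖ ≤ n + α * (K₂ * (1 + n)) := by
    have := norm_add_le u (v - u)
    rw [add_sub_cancel] at this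
    linarith
  have hvR : 1 + ‖v‖ ^ 2 ≤ R * (1 + n ^ 2) := by
    have h1 : ‖v‖ ^ 2 ≤ (n + α * (K₂ * (1 + n))) ^ 2 := by gcongr
    have h2 : (n + α * (K₂ * (1 + n))) ^ 2 ≤ 2 * n ^ 2 + 2 * (α * K₂) ^ 2 * (1 + n) ^ 2 := by
      nlinarith [sq_nonneg (n - α * (K₂ * (1 + n)))]
    have h3 := mul_le_mul_of_nonneg_left hn2 (by positivity : 0 ≤ 2 * (α * K₂) ^ 2)
    rw [hR]
    linarith
  refine ⟨hvR, ?_⟩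
  have hnorm : ‖v‖ ^ 2 = n ^ 2 + 2 * a * inner ℝ u h + a ^ 2 * ‖h‖ ^ 2 := by
    rw [hv, norm_add_sq_real, real_inner_smul_right, norm_smul, mul_pow, Real.norm_eq_abs, sq_abs]
    ring
  have hh2 : ‖h‖ ^ 2 ≤ 2 * K₂ ^ 2 * (1 + n ^ 2) := by
    have h1 : ‖h‖ ^ 2 ≤ (K₂ * (1 + n)) ^ 2 := by gcongr
    have h2 := mul_le_mul_of_nonneg_left hn2 (sq_nonneg K₂)
    linarith
  have hqv : q v - q u ≤ 2 * (K * (2 + α * K₂) * K₂) * a * (1 + n ^ 2) := by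
    have h1 : q v - q u ≤ K * (1 + ‖v‖ + ‖u‖) * ‖v - u‖ := (le_abs_self _).trans (hq v u)
    have h2 : K * (1 + ‖v‖ + ‖u‖) * ‖v - u‖ ≤
        K * ((2 + α * K₂) * (1 + n)) * (a * (K₂ * (1 + n))) := by
      have : 1 + ‖v‖ + ‖u‖ ≤ (2 + α * K₂) * (1 + n) := by
        rw [← hn]
        linarith
      gcongr
    have h3 := mul_le_mul_of_nonneg_left hn2 (by positivity : 0 ≤ K * (2 + α * K₂) * K₂ * a)
    linarith
  have hqabs : -q v ≤ 2 * K * (R * (1 + n ^ 2)) := by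
    have h1 := hq v 0
    rw [hq0, sub_zero, sub_zero, norm_zero, add_zero] at h1
    have h2 := (neg_abs_le (q v))
    have h3 : (1 + ‖v‖) * ‖v‖ ≤ 2 * (1 + ‖v‖ ^ 2) := by nlinarith [sq_nonneg (1 - ‖v‖)]
    have h4 := mul_le_mul_of_nonneg_left h3 hK
    have h5 := mul_le_mul_of_nonneg_left hvR hK
    linarith
  have h1 := mul_le_mul_of_nonneg_left hh2 (sq_nonneg a)
  have h2 := mul_le_mul_of_nonneg_left hqv ha
  have h3 := mul_le_mul_of_nonneg_left hqabs haa'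
  have h4 := mul_le_mul_of_nonneg_right haa
    (by positivity : 0 ≤ 2 * K * (R * (1 + n ^ 2)))
  rw [hnorm]
  linarith

end OneStep

/-! ### The error process of TD(λ) -/

namespace MDP

section Path

variable {S A : Type*} [Fintype S] [Fintype A] {M : MDP S A} {π : Policy S A}
  {γ lam : ℝ} {d : ℕ} {x : S → EuclideanSpace ℝ (Fin d)}

omit [Fintype S] in
theorem trace_congr {s s' : ℕ → S} : ∀ {t : ℕ}, (∀ i ≤ t, s i = s' i) →
    trace γ lam x s t = trace γ lam x s' t
  | 0, h => by simp only [trace, h 0 le_rfl]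
  | t + 1, h => by
    simp only [trace, trace_congr fun i hi => h i (Nat.le_succ_of_le hi), h (t + 1) le_rfl]

theorem tdIter_dependsUpTo (α : ℕ → ℝ) (w₀ : EuclideanSpace ℝ (Fin d)) :
    ∀ t, DependsUpTo t fun s a => M.tdIter γ lam x α w₀ s a t
  | 0 => fun _ _ _ _ _ _ => rfl
  | t + 1 => fun s s' a a' hs ha => by
    have h1 := tdIter_dependsUpTo α w₀ t s s' a a' (fun i hi => hs i (Nat.le_succ_of_le hi))
      fun i hi => ha i (Nat.lt_succ_of_lt hi)
    have h2 : trace γ lam x s t = trace γ lam x s' t :=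
      trace_congr fun i hi => hs i (Nat.le_succ_of_le hi)
    simp only at h1
    simp only [tdIter, h1, h2, hs t (Nat.le_succ t), hs (t + 1) le_rfl, ha t (Nat.lt_succ_self t)]

omit [Fintype S] in
theorem norm_trace_le (hβ0 : 0 ≤ γ * lam) {R : ℝ} (hR : 0 ≤ R)
    (hx : ∀ s, ‖x s‖ ≤ (1 - γ * lam) * R) (s : ℕ → S) : ∀ t, ‖trace γ lam x s t‖ ≤ R
  | 0 => (hx _).trans (by nlinarith)
  | t + 1 => by
    have h1 := norm_trace_le hβ0 hR hx s t
    refine (norm_add_le _ _).trans ?_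
    rw [norm_smul, Real.norm_of_nonneg hβ0]
    have := hx (s (t + 1))
    nlinarith

omit [Fintype S] in
theorem trace_mem {V : Submodule ℝ (EuclideanSpace ℝ (Fin d))} (hx : ∀ s, x s ∈ V) (s : ℕ → S) :
    ∀ t, trace γ lam x s t ∈ V
  | 0 => hx _
  | t + 1 => V.add_mem (V.smul_mem _ (trace_mem hx s t)) (hx _)

/-- The temporal-difference error of the transition `(s, a, s')` under the parameter `v`. -/
noncomputable def tdError (M : MDP S A) (γ : ℝ) (x : S → EuclideanSpace ℝ (Fin d)) (s : S) (a : A)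
    (s' : S) (v : EuclideanSpace ℝ (Fin d)) : ℝ :=
  M.r s a + γ * inner ℝ (x s') v - inner ℝ (x s) v

/-- The features span `V`, so the component of the error orthogonal to `V` is never updated and does
not enter the temporal-difference error: the projected error follows the TD recursion. -/
theorem starProjection_tdIter_succ {V : Submodule ℝ (EuclideanSpace ℝ (Fin d))}
    (hx : ∀ s, x s ∈ V) (α : ℕ → ℝ) (w₀ wstar : EuclideanSpace ℝ (Fin d)) (s : ℕ → S) (a : ℕ → A)
    (t : ℕ) :
    V.starProjection (M.tdIter γ lam x α w₀ s a (t + 1) - wstar) =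
      V.starProjection (M.tdIter γ lam x α w₀ s a t - wstar) +
        α t • (M.tdError γ x (s t) (a t) (s (t + 1))
          (V.starProjection (M.tdIter γ lam x α w₀ s a t - wstar) + wstar) •
            trace γ lam x s t) := by
  set w := M.tdIter γ lam x α w₀ s a t with hw
  have hinner : ∀ s, inner ℝ (x s) (V.starProjection (w - wstar) + wstar) = inner ℝ (x s) w := by
    intro s
    rw [inner_add_right, ← V.inner_starProjection_left_eq_right,
      Submodule.starProjection_eq_self_iff.2 (hx s), ← inner_add_right, sub_add_cancel]
  have hsucc : M.tdIter γ lam x α w₀ s a (t + 1) = w +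
      (α t * (M.r (s t) (a t) + γ * inner ℝ (x (s (t + 1))) w - inner ℝ (x (s t)) w)) •
        trace γ lam x s t := rfl
  rw [hsucc, add_sub_right_comm, map_add, map_smul,
    Submodule.starProjection_eq_self_iff.2 (trace_mem hx s t), smul_smul, tdError, hinner, hinner]

theorem sum_prob_mul (M : MDP S A) (π : Policy S A) (s : S) (f : S → ℝ) :
    ∑ b, ∑ s', π.prob s b * M.p s b s' * f s' = ∑ s', M.transMatrix π s s' * f s' := by
  rw [Finset.sum_comm]
  exact Finset.sum_congr rfl fun s' _ => by
    rw [transMatrix, Matrix.of_apply, Finset.sum_mul]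

theorem sum_prob_mul_tdError [DecidableEq S] (s : S) (v : EuclideanSpace ℝ (Fin d)) :
    ∑ b, ∑ s', π.prob s b * M.p s b s' * M.tdError γ x s b s' v = M.meanError π γ x v s := by
  have h1 := M.sum_prob_mul π s fun s' => γ * inner ℝ (x s') v - inner ℝ (x s) v
  have h2 : ∑ b, ∑ s', π.prob s b * M.p s b s' * M.r s b = M.rPi π s :=
    Finset.sum_congr rfl fun b _ => by
      rw [← Finset.sum_mul, ← Finset.mul_sum, (M.p_mem s b).2, mul_one]
  have h3 : ∑ s', M.transMatrix π s s' * (γ * inner ℝ (x s') v - inner ℝ (x s) v) =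
      γ * ∑ s', M.transMatrix π s s' * inner ℝ (x s') v - inner ℝ (x s) v := by
    simp only [mul_sub, Finset.sum_sub_distrib, ← Finset.sum_mul, M.transMatrix_row_sum, one_mul,
      Finset.mul_sum]
    congr 1
    exact Finset.sum_congr rfl fun s' _ => by ring
  rw [meanError, add_sub_assoc, ← h3, ← h2, ← h1, ← Finset.sum_add_distrib]
  refine Finset.sum_congr rfl fun b _ => ?_
  rw [← Finset.sum_add_distrib]
  exact Finset.sum_congr rfl fun s' _ => by rw [tdError]; ring

end Path

section Expectation

variable {S A : Type*} [Fintype S] [DecidableEq S] [Fintype A] {M : MDP S A} {π : Policy S A}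
  {γ lam : ℝ} {d : ℕ} {x : S → EuclideanSpace ℝ (Fin d)}

omit [DecidableEq S] in
theorem exists_norm_tdError_smul_le (hγ0 : 0 ≤ γ) (hγ1 : γ ≤ 1) {R : ℝ} (hR : ∀ s, ‖x s‖ ≤ R)
    (M : MDP S A) (wstar : EuclideanSpace ℝ (Fin d)) :
    ∃ K : ℝ, 0 ≤ K ∧ ∀ s a s' (u e : EuclideanSpace ℝ (Fin d)), ‖e‖ ≤ R →
      ‖M.tdError γ x s a s' (u + wstar) • e‖ ≤ K * (1 + ‖u‖) := by
  have hR0 : 0 ≤ R := (norm_nonneg _).trans (hR M.nonempty_state.some)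
  set B := ∑ s, ∑ a, |M.r s a| with hB
  have hB0 : 0 ≤ B := Finset.sum_nonneg fun s _ => Finset.sum_nonneg fun a _ => abs_nonneg _
  have hr : ∀ s a, |M.r s a| ≤ B := fun s a =>
    (Finset.single_le_sum (f := fun a => |M.r s a|) (fun a _ => abs_nonneg _)
      (Finset.mem_univ a)).trans
    (Finset.single_le_sum (f := fun s => ∑ a, |M.r s a|)
      (fun s _ => Finset.sum_nonneg fun a _ => abs_nonneg _) (Finset.mem_univ s))
  refine ⟨(B + 2 * R + 2 * R * ‖wstar‖) * R, by positivity, fun s a s' u e he => ?_⟩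
  have h1 : ∀ s, |inner ℝ (x s) (u + wstar)| ≤ R * (‖u‖ + ‖wstar‖) := fun s =>
    (abs_real_inner_le_norm _ _).trans
      (mul_le_mul (hR s) (norm_add_le _ _) (norm_nonneg _) hR0)
  have h2 : |γ * inner ℝ (x s') (u + wstar)| ≤ R * (‖u‖ + ‖wstar‖) := by
    rw [abs_mul, abs_of_nonneg hγ0]
    have := h1 s'
    have := abs_nonneg (inner ℝ (x s') (u + wstar))
    nlinarith
  have h3 : ‖M.tdError γ x s a s' (u + wstar)‖ ≤
      (B + 2 * R + 2 * R * ‖wstar‖) * (1 + ‖u‖) := by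
    have h4 := abs_sub (M.r s a + γ * inner ℝ (x s') (u + wstar)) (inner ℝ (x s) (u + wstar))
    have h5 := abs_add_le (M.r s a) (γ * inner ℝ (x s') (u + wstar))
    have h6 := h1 s
    have h7 := hr s a
    have h8 : 0 ≤ B * ‖u‖ + 2 * R * ‖wstar‖ * ‖u‖ + 2 * R := by positivity
    rw [Real.norm_eq_abs, tdError]
    linarith
  rw [norm_smul]
  calc _ ≤ (B + 2 * R + 2 * R * ‖wstar‖) * (1 + ‖u‖) * R := by gcongr
    _ = _ := by ring

/-- The averaged one-step identity behind the drift of the Lyapunov function. -/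
theorem sum_prob_mul_lyapunov (hdet : IsUnit (1 - (γ * lam) • M.transMatrix π).det)
    {wstar : EuclideanSpace ℝ (Fin d)} (hw : wstar ∈ M.solSet π γ lam x) {Z : S → S → ℝ}
    (hZ : ∀ s i, Z s i - ∑ s', M.transMatrix π s s' * Z s' i =
      (if s = i then 1 else 0) - M.statDist π i)
    (s : S) (e u : EuclideanSpace ℝ (Fin d)) :
    ∑ b, ∑ s', π.prob s b * M.p s b s' *
      (inner ℝ u (M.tdError γ x s b s' (u + wstar) • e) +
        M.poissonFun π γ lam x wstar Z s' ((γ * lam) • e + x s') u) =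
      inner ℝ u (Matrix.toEuclideanLin (M.tdA π γ lam x) u) +
        M.poissonFun π γ lam x wstar Z s e u := by
  have h1 := inner_mul_meanError_eq hdet hw hZ s e u
  rw [← sum_prob_mul_tdError, ← sum_prob_mul, Finset.mul_sum] at h1
  have h2 : ∀ b, inner ℝ u e * ∑ s', π.prob s b * M.p s b s' * M.tdError γ x s b s' (u + wstar) =
      ∑ s', π.prob s b * M.p s b s' * inner ℝ u (M.tdError γ x s b s' (u + wstar) • e) := by
    intro b
    rw [Finset.mul_sum]
    exact Finset.sum_congr rfl fun s' _ => by rw [real_inner_smul_right]; ring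
  rw [Finset.sum_congr rfl fun b _ => h2 b] at h1
  simp only [mul_add, Finset.sum_add_distrib]
  linarith

theorem step_size_sub_le {α t₀ ξ : ℝ} (hα : 0 < α) (ht₀ : 1 ≤ t₀) (hξ0 : 0 ≤ ξ) (hξ1 : ξ ≤ 1)
    (t : ℕ) :
    0 ≤ α / ((t : ℝ) + t₀) ^ ξ - α / (((t + 1 : ℕ) : ℝ) + t₀) ^ ξ ∧
      α / ((t : ℝ) + t₀) ^ ξ - α / (((t + 1 : ℕ) : ℝ) + t₀) ^ ξ ≤
        α⁻¹ * (α / ((t : ℝ) + t₀) ^ ξ) ^ 2 := by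
  have hτ : 1 ≤ (t : ℝ) + t₀ := by have := Nat.cast_nonneg (α := ℝ) t; linarith
  have e : (((t + 1 : ℕ) : ℝ) + t₀) = (t : ℝ) + t₀ + 1 := by push_cast; ring
  rw [e]
  set τ := (t : ℝ) + t₀ with hτdef
  have hτ0 : 0 < τ := by linarith
  have hpos : 0 < τ ^ ξ := Real.rpow_pos_of_pos hτ0 ξ
  constructor
  · rw [sub_nonneg]
    gcongr
    linarith
  · have h1 := one_sub_div_mul_rpow_neg_le hτ hξ0 hξ1
    rw [Real.rpow_neg hτ0.le, Real.rpow_neg (by linarith : 0 ≤ τ + 1)] at h1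
    have h2 : ξ / τ ≤ (τ ^ ξ)⁻¹ := by
      rw [div_eq_mul_inv, ← Real.rpow_neg hτ0.le]
      have h3 : τ⁻¹ ≤ τ ^ (-ξ) := by
        rw [← Real.rpow_neg_one]
        exact Real.rpow_le_rpow_of_exponent_le hτ (by linarith)
      have h4 : 0 < τ⁻¹ := inv_pos.2 hτ0
      nlinarith
    have h3 := mul_le_mul_of_nonneg_right h2 (inv_nonneg.2 hpos.le)
    have h4 : α⁻¹ * (α / τ ^ ξ) ^ 2 = α * ((τ ^ ξ)⁻¹ * (τ ^ ξ)⁻¹) := by field_simp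
    rw [h4, div_eq_mul_inv, div_eq_mul_inv, ← mul_sub]
    refine mul_le_mul_of_nonneg_left ?_ hα.le
    linarith

end Expectation

end MDP

/-! ### The mean square error -/

namespace MDP

variable {S A : Type*} [Fintype S] [DecidableEq S] [Fintype A] {M : MDP S A} {π : Policy S A}
  {γ lam : ℝ} {d : ℕ} {x : S → EuclideanSpace ℝ (Fin d)}

/-- The mean square bound without logarithm. The Lyapunov sequence is
`m t = E[‖u_t‖² + 2 α_t Q(S_t, e_t, u_t)]` with `u_t` the error projected to `ker(A)ᗮ` and `Q` the
Poisson function: `Q` absorbs the Markovian noise exactly, up to terms of order `α_t²`. -/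
theorem exists_meanSquare_bound (hirr : (M.transMatrix π).IsIrreducible) (hγ0 : 0 ≤ γ)
    (hγ1 : γ < 1) (hlam0 : 0 ≤ lam) (hlam1 : lam ≤ 1) {c : ℝ} (hc : 0 < c)
    (hneg : (M.tdA π γ lam x).NegDefOnKerPerp c) {ξ : ℝ} (hξ0 : 1 / 2 < ξ) (hξ1 : ξ ≤ 1) {α : ℝ}
    (hα : 2 ≤ α * c) {t₀ : ℝ} (ht₀ : 1 ≤ t₀) :
    ∃ C : ℝ, 0 < C ∧ ∀ (w₀ : EuclideanSpace ℝ (Fin d)) (Ω : Type*) (_ : MeasurableSpace Ω)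
      (μ : Measure Ω) (_ : IsProbabilityMeasure μ) (X : ℕ → Ω → S) (U : ℕ → Ω → A),
      M.IsTrajectory π μ X U → ∀ t : ℕ,
        Integrable (fun ω => Metric.infDist (M.tdIter γ lam x (fun t => α / ((t : ℝ) + t₀) ^ ξ) w₀
          (fun n => X n ω) (fun n => U n ω) t) (M.solSet π γ lam x) ^ 2) μ ∧
        ∫ ω, Metric.infDist (M.tdIter γ lam x (fun t => α / ((t : ℝ) + t₀) ^ ξ) w₀
          (fun n => X n ω) (fun n => U n ω) t) (M.solSet π γ lam x) ^ 2 ∂μ ≤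
          C * ((((t : ℝ) + t₀) ^ ⌊α * c⌋₊)⁻¹ * Metric.infDist w₀ (M.solSet π γ lam x) ^ 2 +
            ((t : ℝ) + t₀) ^ (-(2 * ξ - 1))) := by
  have hα0 : 0 < α := by
    by_contra! h
    nlinarith
  have hdet := M.isUnit_det_resolvent π hγ0 hγ1 hlam0 hlam1
  have hstat := M.statDist_spec π
  obtain ⟨wstar, hw⟩ := solSet_nonempty (x := x) hirr hγ0 hγ1 hlam0 hlam1
  obtain ⟨Z, hZ⟩ := exists_poisson_kernel hirr (M.transMatrix_row_sum π) hstat.1.2 hstat.2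
  have hβ0 : 0 ≤ γ * lam := mul_nonneg hγ0 hlam0
  have hβ1 : 0 < 1 - γ * lam := by nlinarith
  set V := (LinearMap.ker (Matrix.toEuclideanLin (M.tdA π γ lam x)))ᗮ with hV
  have hxV : ∀ s, x s ∈ V := feature_mem_ker_orthogonal hirr hγ0 hγ1 hlam0 hlam1
  -- `R` bounds the features and the traces.
  set R := (∑ s, ‖x s‖) / (1 - γ * lam) with hRdef
  have hR0 : 0 ≤ R := div_nonneg (Finset.sum_nonneg fun s _ => norm_nonneg _) hβ1.le
  have hxβ : ∀ s, ‖x s‖ ≤ (1 - γ * lam) * R := fun s => by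
    rw [hRdef, mul_div_cancel₀ _ hβ1.ne']
    exact Finset.single_le_sum (f := fun s => ‖x s‖) (fun i _ => norm_nonneg _)
      (Finset.mem_univ s)
  have hxR : ∀ s, ‖x s‖ ≤ R := fun s => (hxβ s).trans (by nlinarith)
  have heR : ∀ s t, ‖trace γ lam x s t‖ ≤ R := fun s t => norm_trace_le hβ0 hR0 hxβ s t
  obtain ⟨K, hK0, hK⟩ := abs_poissonFun_sub_le (M := M) (π := π) (γ := γ) (lam := lam) wstar Z hxR
  obtain ⟨K₂, hK₂0, hK₂⟩ := exists_norm_tdError_smul_le hγ0 hγ1.le hxR M wstar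
  obtain ⟨C₁, R₁, hC₁0, hR₁, hone⟩ := exists_lyapunov_step_bound
    (E := EuclideanSpace ℝ (Fin d)) hα0.le hK0 hK₂0 (inv_nonneg.2 hα0.le)
  obtain ⟨C, hC0, hC⟩ := exists_bound_of_lyapunov_recursion (K := 4 * K + C₁) (R := R₁) hc hα ht₀
    hξ0 hξ1 (by positivity) hR₁
  refine ⟨C, hC0, ?_⟩
  intro w₀ Ω _ μ _ X U htraj
  set a : ℕ → ℝ := fun t => α / ((t : ℝ) + t₀) ^ ξ with ha
  have hτ : ∀ t : ℕ, 1 ≤ (t : ℝ) + t₀ := fun t => by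
    have := Nat.cast_nonneg (α := ℝ) t; linarith
  have ha0 : ∀ t, 0 ≤ a t := fun t => by
    have := hτ t
    simp only [ha]
    positivity
  have haα : ∀ t, a t ≤ α := fun t =>
    div_le_self hα0.le (Real.one_le_rpow (hτ t) (by linarith))
  set u : (ℕ → S) → (ℕ → A) → ℕ → EuclideanSpace ℝ (Fin d) := fun s b t =>
    V.starProjection (M.tdIter γ lam x a w₀ s b t - wstar) with hu
  have huV : ∀ s b t, u s b t ∈ V := fun s b t => V.starProjection_apply_mem _
  have hdist : ∀ s b t, Metric.infDist (M.tdIter γ lam x a w₀ s b t) (M.solSet π γ lam x) =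
      ‖u s b t‖ := fun s b t => infDist_solSet hw _
  have hdist0 : Metric.infDist w₀ (M.solSet π γ lam x) = ‖V.starProjection (w₀ - wstar)‖ :=
    infDist_solSet hw _
  set Q : S → EuclideanSpace ℝ (Fin d) → EuclideanSpace ℝ (Fin d) → ℝ :=
    M.poissonFun π γ lam x wstar Z with hQ
  have hQ0 : ∀ s e, Q s e 0 = 0 := poissonFun_zero wstar Z
  have hQabs : ∀ s e v, ‖e‖ ≤ R → |Q s e v| ≤ 2 * K * (1 + ‖v‖ ^ 2) := by
    intro s e v he
    have h1 := hK s e he v 0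
    rw [hQ0, sub_zero, sub_zero, norm_zero, add_zero] at h1
    have h2 : (1 + ‖v‖) * ‖v‖ ≤ 2 * (1 + ‖v‖ ^ 2) := by nlinarith [sq_nonneg (1 - ‖v‖)]
    have h3 := mul_le_mul_of_nonneg_left h2 hK0
    linarith
  have hcongr : ∀ t s s' b b', (∀ i ≤ t, s i = s' i) → (∀ i < t, b i = b' i) →
      s t = s' t ∧ trace γ lam x s t = trace γ lam x s' t ∧ u s b t = u s' b' t := by
    intro t s s' b b' hs hb
    refine ⟨hs t le_rfl, trace_congr hs, ?_⟩
    have h1 := tdIter_dependsUpTo (M := M) (γ := γ) (lam := lam) (x := x) a w₀ t s s' b b' hs hb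
    simp only at h1
    simp only [hu, h1]
  have hint : ∀ t (f : S → EuclideanSpace ℝ (Fin d) → EuclideanSpace ℝ (Fin d) → ℝ),
      Integrable (fun ω => f (X t ω) (trace γ lam x (fun n => X n ω) t)
        (u (fun n => X n ω) (fun n => U n ω) t)) μ := fun t f =>
    htraj.integrable (F := fun s b => f (s t) (trace γ lam x s t) (u s b t))
      fun s s' b b' hs hb => by
        obtain ⟨h1, h2, h3⟩ := hcongr t s s' b b' hs hb
        simp only [h1, h2, h3]
  -- Pathwise step, with the next state and action made explicit.
  have hstep : ∀ s b t,
      1 + ‖u s b (t + 1)‖ ^ 2 ≤ R₁ * (1 + ‖u s b t‖ ^ 2) ∧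
      ‖u s b (t + 1)‖ ^ 2 + 2 * a (t + 1) *
          Q (s (t + 1)) (trace γ lam x s (t + 1)) (u s b (t + 1)) ≤
        ‖u s b t‖ ^ 2 + 2 * a t * (inner ℝ (u s b t)
            (M.tdError γ x (s t) (b t) (s (t + 1)) (u s b t + wstar) • trace γ lam x s t) +
          Q (s (t + 1)) ((γ * lam) • trace γ lam x s t + x (s (t + 1))) (u s b t)) +
        C₁ * a t ^ 2 * (1 + ‖u s b t‖ ^ 2) := by
    intro s b t
    have h1 : u s b (t + 1) = u s b t + a t •
        (M.tdError γ x (s t) (b t) (s (t + 1)) (u s b t + wstar) • trace γ lam x s t) :=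
      starProjection_tdIter_succ hxV a w₀ wstar s b t
    obtain ⟨h2, h3⟩ := step_size_sub_le hα0 ht₀ (by linarith : 0 ≤ ξ) hξ1 t
    rw [h1]
    exact hone (Q (s (t + 1)) (trace γ lam x s (t + 1))) (u s b t) _ (a t) (a (t + 1))
      (hQ0 _ _) (hK _ _ (heR _ _)) (hK₂ _ _ _ _ _ (heR _ _)) (ha0 t) (haα t) h2 h3
  set ℓ : ℕ → ℝ := fun t => ∫ ω, ‖u (fun n => X n ω) (fun n => U n ω) t‖ ^ 2 ∂μ with hℓ
  set m : ℕ → ℝ := fun t => ∫ ω, (‖u (fun n => X n ω) (fun n => U n ω) t‖ ^ 2 + 2 * a t *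
    Q (X t ω) (trace γ lam x (fun n => X n ω) t) (u (fun n => X n ω) (fun n => U n ω) t)) ∂μ
    with hm
  have hintu : ∀ t, Integrable (fun ω => ‖u (fun n => X n ω) (fun n => U n ω) t‖ ^ 2) μ :=
    fun t => hint t fun _ _ v => ‖v‖ ^ 2
  have hintQ : ∀ t, Integrable (fun ω => Q (X t ω) (trace γ lam x (fun n => X n ω) t)
      (u (fun n => X n ω) (fun n => U n ω) t)) μ := fun t => hint t Q
  have hint1 : ∀ t, Integrable
      (fun ω => 1 + ‖u (fun n => X n ω) (fun n => U n ω) t‖ ^ 2) μ :=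
    fun t => hint t fun _ _ v => 1 + ‖v‖ ^ 2
  have hone_add : ∀ t, ∫ ω, (1 + ‖u (fun n => X n ω) (fun n => U n ω) t‖ ^ 2) ∂μ = 1 + ℓ t := by
    intro t
    rw [integral_add (integrable_const _) (hintu t)]
    simp [hℓ]
  have hℓ0 : ∀ t, 0 ≤ ℓ t := fun t => integral_nonneg fun ω => sq_nonneg _
  have hmℓ : ∀ t, |m t - ℓ t| ≤ (4 * K + C₁) * a t * (1 + ℓ t) := by
    intro t
    have h1 : m t - ℓ t = 2 * a t * ∫ ω, Q (X t ω) (trace γ lam x (fun n => X n ω) t)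
        (u (fun n => X n ω) (fun n => U n ω) t) ∂μ := by
      simp only [hm, hℓ]
      rw [integral_add (hintu t) ((hintQ t).const_mul _), integral_const_mul]
      ring
    have h2 : |∫ ω, Q (X t ω) (trace γ lam x (fun n => X n ω) t)
        (u (fun n => X n ω) (fun n => U n ω) t) ∂μ| ≤ 2 * K * (1 + ℓ t) := by
      refine (abs_integral_le_integral_abs).trans ?_
      rw [← hone_add, ← integral_const_mul]
      exact integral_mono (hintQ t).abs ((hint1 t).const_mul _) fun ω => hQabs _ _ _ (heR _ _)
    rw [h1, abs_mul, abs_of_nonneg (mul_nonneg zero_le_two (ha0 t))]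
    have h3 := mul_le_mul_of_nonneg_left h2 (mul_nonneg zero_le_two (ha0 t))
    have h4 : 0 ≤ C₁ * a t * (1 + ℓ t) :=
      mul_nonneg (mul_nonneg hC₁0 (ha0 t)) (by linarith [hℓ0 t])
    linarith
  have hmstep : ∀ t, m (t + 1) ≤
      m t - 2 * c * a t * ℓ t + (4 * K + C₁) * a t ^ 2 * (1 + ℓ t) := by
    intro t
    set H : (ℕ → S) → (ℕ → A) → A → S → ℝ := fun s b b' s' =>
      ‖u s b t‖ ^ 2 + 2 * a t * (inner ℝ (u s b t)
          (M.tdError γ x (s t) b' s' (u s b t + wstar) • trace γ lam x s t) +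
        Q s' ((γ * lam) • trace γ lam x s t + x s') (u s b t)) with hH
    have hHdep : DependsUpTo t H := by
      intro s s' b b' hs hb
      obtain ⟨h1, h2, h3⟩ := hcongr t s s' b b' hs hb
      simp only [hH, h1, h2, h3]
    have hmarkov := htraj.integral_step hHdep
    have hmean : ∀ ω, ∑ b, ∑ s', π.prob (X t ω) b * M.p (X t ω) b s' *
        H (fun n => X n ω) (fun n => U n ω) b s' =
        ‖u (fun n => X n ω) (fun n => U n ω) t‖ ^ 2 + 2 * a t *
          (inner ℝ (u (fun n => X n ω) (fun n => U n ω) t)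
            (Matrix.toEuclideanLin (M.tdA π γ lam x) (u (fun n => X n ω) (fun n => U n ω) t)) +
          Q (X t ω) (trace γ lam x (fun n => X n ω) t)
            (u (fun n => X n ω) (fun n => U n ω) t)) := by
      intro ω
      rw [hQ, ← sum_prob_mul_lyapunov hdet hw hZ]
      have h1 : ∀ n : ℝ, ∑ b, ∑ s', π.prob (X t ω) b * M.p (X t ω) b s' * n = n := fun n => by
        rw [sum_prob_mul M π (X t ω) fun _ => n, ← Finset.sum_mul, M.transMatrix_row_sum, one_mul]
      nth_rewrite 1 [← h1 (‖u (fun n => X n ω) (fun n => U n ω) t‖ ^ 2)]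
      simp only [Finset.mul_sum, ← Finset.sum_add_distrib]
      refine Finset.sum_congr rfl fun b _ => Finset.sum_congr rfl fun s' _ => ?_
      simp only [hH, hQ]
      ring
    have hdrift : ∫ ω, H (fun n => X n ω) (fun n => U n ω) (U t ω) (X (t + 1) ω) ∂μ ≤
        m t - 2 * c * a t * ℓ t := by
      have h1 : m t - 2 * c * a t * ℓ t =
          ∫ ω, (‖u (fun n => X n ω) (fun n => U n ω) t‖ ^ 2 + 2 * a t *
            Q (X t ω) (trace γ lam x (fun n => X n ω) t)
              (u (fun n => X n ω) (fun n => U n ω) t) -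
            2 * c * a t * ‖u (fun n => X n ω) (fun n => U n ω) t‖ ^ 2) ∂μ := by
        simp only [hm, hℓ]
        rw [integral_sub (hint t fun s e v => ‖v‖ ^ 2 + 2 * a t * Q s e v) ((hintu t).const_mul _),
          integral_const_mul]
      rw [hmarkov, h1]
      simp only [hmean]
      refine integral_mono
        (hint t fun s e v => ‖v‖ ^ 2 + 2 * a t *
          (inner ℝ v (Matrix.toEuclideanLin (M.tdA π γ lam x) v) + Q s e v))
        (hint t fun s e v => ‖v‖ ^ 2 + 2 * a t * Q s e v - 2 * c * a t * ‖v‖ ^ 2) fun ω => ?_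
      have h2 := mul_le_mul_of_nonneg_left
        (hneg _ (huV (fun n => X n ω) (fun n => U n ω) t)) (ha0 t)
      simp only
      linarith
    have hupper : m (t + 1) ≤
        ∫ ω, H (fun n => X n ω) (fun n => U n ω) (U t ω) (X (t + 1) ω) ∂μ +
          C₁ * a t ^ 2 * (1 + ℓ t) := by
      have hHint : Integrable
          (fun ω => H (fun n => X n ω) (fun n => U n ω) (U t ω) (X (t + 1) ω)) μ := by
        refine htraj.integrable (t := t + 1) (F := fun s b => H s b (b t) (s (t + 1))) ?_
        intro s s' b b' hs hb
        simp only [hHdep s s' b b' (fun i hi => hs i (Nat.le_succ_of_le hi))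
          fun i hi => hb i (Nat.lt_succ_of_lt hi), hb t (Nat.lt_succ_self t), hs (t + 1) le_rfl]
      rw [← hone_add, ← integral_const_mul, ← integral_add hHint ((hint1 t).const_mul _)]
      exact integral_mono ((hintu (t + 1)).add ((hintQ (t + 1)).const_mul _))
        (hHint.add ((hint1 t).const_mul _)) fun ω => (hstep _ _ t).2
    have h3 : 0 ≤ 4 * K * a t ^ 2 * (1 + ℓ t) :=
      mul_nonneg (by positivity) (by linarith [hℓ0 t])
    linarith
  have hgrow : ∀ t, 1 + ℓ (t + 1) ≤ R₁ * (1 + ℓ t) := by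
    intro t
    rw [← hone_add, ← hone_add, ← integral_const_mul]
    exact integral_mono (hint1 (t + 1)) ((hint1 t).const_mul _) fun ω => (hstep _ _ t).1
  intro t
  simp only [hdist, hdist0]
  refine ⟨hintu t, ?_⟩
  have hfin := hC a ℓ m (fun _ => rfl) hℓ0 hmℓ hmstep hgrow t
  have hℓzero : ℓ 0 = ‖V.starProjection (w₀ - wstar)‖ ^ 2 := by
    simp only [hℓ, hu, tdIter]
    simp
  rw [hℓzero] at hfin
  exact hfin

end MDP

theorem theorem1 {S A : Type*} [Fintype S] [DecidableEq S] [Fintype A]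
    (M : MDP S A) (π : Policy S A)
    (hirr : (M.transMatrix π).IsIrreducible) (haper : (M.transMatrix π).IsAperiodic)
    (γ : ℝ) (hγ0 : 0 ≤ γ) (hγ1 : γ < 1)
    (lam : ℝ) (hlam0 : 0 ≤ lam) (hlam1 : lam ≤ 1)
    {d : ℕ} (x : S → EuclideanSpace ℝ (Fin d)) :
    (M.solSet π γ lam x).Nonempty ∧
    (∃ c : ℝ, 0 < c ∧ (M.tdA π γ lam x).NegDefOnKerPerp c) ∧
    ∀ c : ℝ, 0 < c → (M.tdA π γ lam x).NegDefOnKerPerp c →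
      ∀ ξ : ℝ, 1 / 2 < ξ → ξ ≤ 1 →
        ∃ α₀ : ℝ, 0 < α₀ ∧ ∃ T₀ : ℝ, 0 < T₀ ∧
          ∀ α : ℝ, α₀ ≤ α → ∀ t₀ : ℝ, T₀ ≤ t₀ →
            1 < α * c ∧
            ∃ C : ℝ, 0 < C ∧
              ∀ (w₀ : EuclideanSpace ℝ (Fin d))
                (Ω : Type*) (_ : MeasurableSpace Ω) (μ : Measure Ω) (_ : IsProbabilityMeasure μ)
                (X : ℕ → Ω → S) (U : ℕ → Ω → A), M.IsTrajectory π μ X U →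
              ∀ w : ℕ → Ω → EuclideanSpace ℝ (Fin d),
                (∀ t ω, w t ω = M.tdIter γ lam x (fun t => α / ((t : ℝ) + t₀) ^ ξ) w₀
                  (fun n => X n ω) (fun n => U n ω) t) →
              ∀ t : ℕ, 1 ≤ t →
                Integrable (fun ω => Metric.infDist (w t ω) (M.solSet π γ lam x) ^ 2) μ ∧
                ∫ ω, Metric.infDist (w t ω) (M.solSet π γ lam x) ^ 2 ∂μ ≤
                  C * ((t₀ / (t : ℝ)) ^ ⌊α * c⌋₊ * Metric.infDist w₀ (M.solSet π γ lam x) ^ 2 +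
                    Real.log ((t : ℝ) + t₀) /
                      ((t : ℝ) + t₀) ^ min (2 * ξ - 1) ((⌊α * c⌋₊ : ℝ) - 1)) := by
  refine ⟨MDP.solSet_nonempty hirr hγ0 hγ1 hlam0 hlam1,
    MDP.exists_negDefOnKerPerp_tdA hirr hγ0 hγ1 hlam0 hlam1, ?_⟩
  intro c hc hneg ξ hξ0 hξ1
  -- `α ≥ 2 / c` gives `κ ≥ 2`. No larger `t₀` is needed: the early steps, where the step size is
  -- not yet small, go into the constant `C`, which may depend on `α`.
  refine ⟨2 / c, by positivity, 1, one_pos, fun α hα t₀ ht₀ => ?_⟩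
  have hκ : 2 ≤ α * c := (div_le_iff₀ hc).1 hα
  refine ⟨by linarith, ?_⟩
  obtain ⟨C, hC0, hC⟩ := MDP.exists_meanSquare_bound hirr hγ0 hγ1 hlam0 hlam1 hc hneg hξ0 hξ1 hκ ht₀
  have hlog2 : 0 < Real.log 2 := Real.log_pos one_lt_two
  refine ⟨C * (1 + (Real.log 2)⁻¹), by positivity, ?_⟩
  intro w₀ Ω _ μ hμ X U htraj w hw t ht
  obtain ⟨h1, h2⟩ := hC w₀ Ω _ μ hμ X U htraj t
  simp only [hw]
  refine ⟨h1, h2.trans ?_⟩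
  have ht1 : (1 : ℝ) ≤ t := by exact_mod_cast ht
  have hτ : 2 ≤ (t : ℝ) + t₀ := by linarith
  have hτ0 : 0 < (t : ℝ) + t₀ := by linarith
  -- For `α c ≥ 2` the minimum is `2 ξ - 1`.
  have hmin : min (2 * ξ - 1) ((⌊α * c⌋₊ : ℝ) - 1) = 2 * ξ - 1 := by
    have h3 : 2 ≤ ⌊α * c⌋₊ := Nat.le_floor (by exact_mod_cast hκ)
    have h4 : (2 : ℝ) ≤ ⌊α * c⌋₊ := by exact_mod_cast h3
    exact min_eq_left (by linarith)
  rw [hmin, mul_assoc]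
  refine mul_le_mul_of_nonneg_left ?_ hC0.le
  have h3 : (((t : ℝ) + t₀) ^ ⌊α * c⌋₊)⁻¹ ≤ (t₀ / t) ^ ⌊α * c⌋₊ := by
    rw [← inv_pow]
    refine pow_le_pow_left₀ (inv_nonneg.2 hτ0.le) ?_ _
    rw [← one_div, div_le_div_iff₀ hτ0 (by linarith)]
    nlinarith
  have h4 : 0 < ((t : ℝ) + t₀) ^ (2 * ξ - 1) := Real.rpow_pos_of_pos hτ0 _
  have h5 : ((t : ℝ) + t₀) ^ (-(2 * ξ - 1)) ≤
      (Real.log 2)⁻¹ * (Real.log ((t : ℝ) + t₀) / ((t : ℝ) + t₀) ^ (2 * ξ - 1)) := by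
    have h6 : 1 ≤ (Real.log 2)⁻¹ * Real.log ((t : ℝ) + t₀) := by
      rw [inv_mul_eq_div, one_le_div hlog2]
      exact Real.log_le_log two_pos hτ
    rw [Real.rpow_neg hτ0.le, ← mul_div_assoc, ← one_div]
    gcongr
  have h6 : 0 ≤ (t₀ / (t : ℝ)) ^ ⌊α * c⌋₊ * Metric.infDist w₀ (M.solSet π γ lam x) ^ 2 := by
    positivity
  have h7 : 0 ≤ Real.log ((t : ℝ) + t₀) / ((t : ℝ) + t₀) ^ (2 * ξ - 1) :=
    div_nonneg (Real.log_nonneg (by linarith)) h4.le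
  have h8 := mul_le_mul_of_nonneg_right h3 (sq_nonneg (Metric.infDist w₀ (M.solSet π γ lam x)))
  have h9 := mul_nonneg (inv_nonneg.2 hlog2.le) h6
  rw [one_add_mul, mul_add]
  linarith
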